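/- Let $\mathbf p=(\mathbf p(k))_{k\ge 0}$ be a probability distribution on $\mathbb N=\{0,1,2,\dots\}$ with $\mathbf p(0)+\mathbf p(1)<1$ and finite mean, and let $\mathbf q:\mathbb N\to[0,1]$ be such that $\mathbf p(k)\mathbf q(k)>0$ for some $k$. Consider the marked Galton–Watson tree with law $\mathbb P$: independently of each other, each vertex has $k$ children with probability $\mathbf p(k)$ and, given that it has $k$ children, is marked with probability $\mathbf q(k)$. Let $Z_n$ be the number of vertices of generation $n$, $M_n$ the number of marked vertices in generations $0,\dots,n-1$ (so $M_0=0$), and $\mathscr F_n$ the $\sigma$-field generated by the tree up to generation $n$ and the marks up to generation $n-1$. Let $\ell\in\mathbb N$ be such that $\mathbf p$ has a finite moment of order $\ell$, and let $H_0=1$, $H_\ell(x)=\frac1{\ell!}\prod_{j=0}^{\ell-1}(x-j)$ for $\ell\ge1$. Let $r=\min\{k:\mathbf p(k)>0\}$ and, for $s\in(0,1)$, let $\alpha_k(s)=\mathbf p(k)\,(s\mathbf q(k)+1-\mathbf q(k))$ and $f_s(t)=\mathbb E[s^{M_1}t^{Z_1}]$. Let $s\in(0,1)$. Then $f_s$ has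 exactly one fixed point $\kappa(s)$ in $[0,1]$, and for every $n\in\mathbb N$ and every $\Lambda_n\in\mathscr F_n$, $$\lim_{p\to+\infty}\frac{\mathbb E\left[\mathbf 1_{\Lambda_n}H_\ell(Z_{n+p})s^{M_{n+p}}t^{Z_{n+p}}\right]}{\mathbb E\left[H_\ell(Z_{n+p})s^{M_{n+p}}t^{Z_{n+p}}\right]}=\mathbb E[\mathbf 1_{\Lambda_n}B_n],$$ where $(B_n)_{n\ge0}$ is the following $(\mathscr F_n)$-martingale (the expectations are finite, and the denominator is positive for all large $p$): - if $r=0$ and $\ell=0$, for every $t\in[0,1]$: $B_n=s^{M_n}\kappa(s)^{Z_n-1}$, where $\kappa(s)>0$; - if $r=0$ and $\ell>0$, for every $t\in(0,1]$: $B_n=\dfrac{s^{M_n}Z_n\,\kappa(s)^{Z_n-1}}{f_s'(\kappa(s))^n}$, where $\kappa(s)>0$ and $f_s'(\kappa(s))>0$; - if $r=1$, for every $t\in(0,1]$: $B_n=s^{M_n}\alpha_1(s)^{-n}\mathbf 1_{Z_n=1}$; - if $r\ge2$, for every $t\in(0,1]$: $B_n=s^{M_n}\alpha_r(s)^{-\frac{r^n-1}{r-1}}\mathbf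 1_{Z_n=r^n}$. -/

import Mathlib

open MeasureTheory ProbabilityTheory Filter Topology Set

/-! ### Marked trees -/

/-- A marked ordered rooted tree in Neveu's formalism. A vertex is a finite word over the positive
integers; words are stored with their last letter first, so that `i :: u` is the `i`-th child of
`u`, `[]` is the root and `u.length` is the generation of `u`. The set `marked` is the set of
the vertices whose mark is `1`. -/
@[ext]
structure MarkedTree where
  nodes : Set (List ℕ+)
  marked : Set (List ℕ+)
  root_mem : [] ∈ nodes
  parent_mem : ∀ (u : List ℕ+) (i : ℕ+), i :: u ∈ nodes → u ∈ nodes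
  exists_children : ∀ u ∈ nodes, ∃ k : ℕ, ∀ i : ℕ+, i :: u ∈ nodes ↔ (i : ℕ) ≤ k
  marked_subset : marked ⊆ nodes

namespace MarkedTree

/-- The σ-algebra generated by the events "`u` is a vertex" and "`u` is a marked vertex". -/
instance : MeasurableSpace MarkedTree :=
  MeasurableSpace.generateFrom
    ({A | ∃ u : List ℕ+, A = {τ : MarkedTree | u ∈ τ.nodes}} ∪
      {A | ∃ u : List ℕ+, A = {τ : MarkedTree | u ∈ τ.marked}})

theorem measurableSet_mem_nodes (u : List ℕ+) :
    MeasurableSet {τ : MarkedTree | u ∈ τ.nodes} :=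
  MeasurableSpace.measurableSet_generateFrom (Or.inl ⟨u, rfl⟩)

theorem measurableSet_mem_marked (u : List ℕ+) :
    MeasurableSet {τ : MarkedTree | u ∈ τ.marked} :=
  MeasurableSpace.measurableSet_generateFrom (Or.inr ⟨u, rfl⟩)

/-- The restriction to level `n`: the vertices up to generation `n`, with the marks up to
generation `n - 1` (the vertices of generation `n` become unmarked). -/
def restrict (n : ℕ) (τ : MarkedTree) : MarkedTree where
  nodes := {u | u ∈ τ.nodes ∧ u.length ≤ n}
  marked := {u | u ∈ τ.marked ∧ u.length < n}
  root_mem := ⟨τ.root_mem, Nat.zero_le _⟩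
  parent_mem := by
    rintro u i ⟨h, hl⟩
    exact ⟨τ.parent_mem u i h, by simp only [List.length_cons] at hl; omega⟩
  exists_children := by
    rintro u ⟨hu, -⟩
    by_cases hn : u.length + 1 ≤ n
    · obtain ⟨k, hk⟩ := τ.exists_children u hu
      exact ⟨k, fun i => by simp [hk i, hn]⟩
    · exact ⟨0, fun i => by simp [hn]⟩
  marked_subset := fun u hu => ⟨τ.marked_subset hu.1, hu.2.le⟩

theorem measurable_restrict (n : ℕ) : Measurable (restrict n) := by
  refine measurable_generateFrom ?_
  rintro A (⟨u, rfl⟩ | ⟨u, rfl⟩)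
  · exact (measurableSet_mem_nodes u).inter (MeasurableSet.const (u.length ≤ n))
  · exact (measurableSet_mem_marked u).inter (MeasurableSet.const (u.length < n))

theorem restrict_restrict {m n : ℕ} (h : m ≤ n) (τ : MarkedTree) :
    restrict m (restrict n τ) = restrict m τ := by
  ext u
  · simp only [restrict, Set.mem_ofPred_eq]
    exact ⟨fun hu => ⟨hu.1.1, hu.2⟩, fun hu => ⟨⟨hu.1, hu.2.trans h⟩, hu.2⟩⟩
  · simp only [restrict, Set.mem_ofPred_eq]
    exact ⟨fun hu => ⟨hu.1.1, hu.2⟩, fun hu => ⟨⟨hu.1, hu.2.trans_le h⟩, hu.2⟩⟩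

/-- The filtration `𝓕 n` generated by the restriction maps: the tree up to generation `n` and
the marks up to generation `n - 1`. -/
def filtration : Filtration ℕ (inferInstance : MeasurableSpace MarkedTree) where
  seq n := MeasurableSpace.comap (restrict n) inferInstance
  mono' := by
    rintro m n h A ⟨B, hB, rfl⟩
    refine ⟨restrict m ⁻¹' B, measurable_restrict m hB, ?_⟩
    ext τ
    simp only [Set.mem_preimage, restrict_restrict h]
  le' n := (measurable_restrict n).comap_le

/-- `Z n τ` is the number of vertices of generation `n`. -/
noncomputable def Z (n : ℕ) (τ : MarkedTree) : ℕ := {u | u ∈ τ.nodes ∧ u.length = n}.ncard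

/-- `M n τ` is the number of marked vertices up to generation `n - 1`; in particular
`M 0 τ = 0`. -/
noncomputable def M (n : ℕ) (τ : MarkedTree) : ℕ := {u | u ∈ τ.marked ∧ u.length < n}.ncard

/-! ### Marked Galton-Watson trees -/

/-- Given a number of children and a mark for each word, the words that are reached
from the root. -/
def Reached (ξ : List ℕ+ → ℕ × Bool) : List ℕ+ → Prop
  | [] => True
  | i :: u => Reached ξ u ∧ (i : ℕ) ≤ (ξ u).1

/-- The marked tree in which every vertex `u` has `(ξ u).1` children and mark `(ξ u).2`. -/
def ofFamily (ξ : List ℕ+ → ℕ × Bool) : MarkedTree where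
  nodes := {u | Reached ξ u}
  marked := {u | Reached ξ u ∧ (ξ u).2 = true}
  root_mem := trivial
  parent_mem := fun _ _ h => h.1
  exists_children := fun u hu => ⟨(ξ u).1, fun _ => ⟨fun h => h.2, fun h => ⟨hu, h⟩⟩⟩
  marked_subset := fun _ h => h.1

theorem measurableSet_reached (u : List ℕ+) :
    MeasurableSet {ξ : List ℕ+ → ℕ × Bool | Reached ξ u} := by
  induction u with
  | nil => exact MeasurableSet.univ
  | cons i u ih =>
    have h : Measurable fun ξ : List ℕ+ → ℕ × Bool => (ξ u).1 :=
      measurable_fst.comp (measurable_pi_apply u)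
    exact ih.inter (h (measurableSet_Ici (a := (i : ℕ))))

theorem measurable_ofFamily : Measurable ofFamily := by
  refine measurable_generateFrom ?_
  rintro A (⟨u, rfl⟩ | ⟨u, rfl⟩)
  · exact measurableSet_reached u
  · refine (measurableSet_reached u).inter ?_
    exact (measurable_snd.comp (measurable_pi_apply u)) (measurableSet_singleton true)

end MarkedTree

/-- The reproduction-marking law on `ℕ × {0, 1}`:
`p₀(k, 1) = p(k) q(k)` and `p₀(k, 0) = p(k) (1 - q(k))`. -/
noncomputable def markingLaw (p : PMF ℕ) (q : ℕ → unitInterval) : PMF (ℕ × Bool) :=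
  ⟨fun x => p x.1 * ENNReal.ofReal (if x.2 then (q x.1 : ℝ) else 1 - (q x.1 : ℝ)), by
    have h : ∑' x : ℕ × Bool, p x.1 *
        ENNReal.ofReal (if x.2 then (q x.1 : ℝ) else 1 - (q x.1 : ℝ)) = 1 := by
      rw [ENNReal.tsum_prod', ← p.tsum_coe]
      refine tsum_congr fun k => ?_
      rw [tsum_bool, ← mul_add]
      simp only [Bool.false_eq_true, if_false, if_true]
      rw [← ENNReal.ofReal_add (sub_nonneg.2 (q k).2.2) (q k).2.1]
      simp
    rw [← h]
    exact ENNReal.summable.hasSum⟩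

/-- The law of the marked Galton-Watson tree with offspring distribution `p` and mark function
`q`: the law of the tree built from an i.i.d. family of pairs (number of children, mark) with
law `markingLaw p q`. -/
noncomputable def mgwLaw (p : PMF ℕ) (q : ℕ → unitInterval) : Measure MarkedTree :=
  (Measure.infinitePi fun _ : List ℕ+ => (markingLaw p q).toMeasure).map MarkedTree.ofFamily

instance mgwLaw_isProbabilityMeasure (p : PMF ℕ) (q : ℕ → unitInterval) :
    IsProbabilityMeasure (mgwLaw p q) :=
  Measure.isProbabilityMeasure_map MarkedTree.measurable_ofFamily.aemeasurable

/-! ### Penalization -/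

/-- The `ℓ`-th Hilbert polynomial `H_ℓ(x) = x (x - 1) ⋯ (x - ℓ + 1) / ℓ!`. -/
noncomputable def hilbertPoly (ℓ : ℕ) (x : ℝ) : ℝ :=
  (∏ j ∈ Finset.range ℓ, (x - (j : ℝ))) / (ℓ.factorial : ℝ)

/-- The penalization function `H_ℓ(Z_m) s^{M_m} t^{Z_m}`. -/
noncomputable def penalty (ℓ : ℕ) (s t : ℝ) (m : ℕ) (τ : MarkedTree) : ℝ :=
  hilbertPoly ℓ (τ.Z m) * s ^ τ.M m * t ^ τ.Z m

/-- `f_s(t) = 𝔼[s^{M_1} t^{Z_1}]`. -/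
noncomputable def genFun (p : PMF ℕ) (q : ℕ → unitInterval) (s t : ℝ) : ℝ :=
  ∫ τ, s ^ τ.M 1 * t ^ τ.Z 1 ∂(mgwLaw p q)

/-- `r = min {k : p(k) > 0}`. -/
noncomputable def minOffspring (p : PMF ℕ) : ℕ := sInf {k | 0 < p k}

/-- `α_k(s) = p(k) (s q(k) + 1 - q(k))`. -/
noncomputable def alpha (p : PMF ℕ) (q : ℕ → unitInterval) (k : ℕ) (s : ℝ) : ℝ :=
  (p k).toReal * (s * (q k : ℝ) + 1 - (q k : ℝ))

/-- Penalizing the law `P` by the functions `φ m` (where `m` is the generation) gives at the limit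
the martingale `B`: the `φ m` are `P`-integrable, with positive mean for all large `m`
(so that the ratios below make sense), `B` is a martingale, and for all `n` and `Λ ∈ 𝓕 n`,
`𝔼[1_Λ φ (n + k)] / 𝔼[φ (n + k)] → 𝔼[1_Λ B n]` as `k → ∞`. -/
def PenalizationLimit (P : Measure MarkedTree) (φ B : ℕ → MarkedTree → ℝ) : Prop :=
  (∀ m, Integrable (φ m) P) ∧
  (∀ᶠ m in atTop, 0 < ∫ τ, φ m τ ∂P) ∧
  (∀ n, Integrable (B n) P) ∧
  Martingale B MarkedTree.filtration P ∧
  ∀ (n : ℕ) (Λ : Set MarkedTree), MeasurableSet[MarkedTree.filtration n] Λ →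
    Tendsto (fun k : ℕ => (∫ τ in Λ, φ (n + k) τ ∂P) / ∫ τ, φ (n + k) τ ∂P) atTop
      (𝓝 (∫ τ in Λ, B n τ ∂P))

/-! Since `H_ℓ(z) t^z` is the coefficient of `X^ℓ` in `(t(1+X))^z`, the penalty is handled through
power series. Let `F(P) = ∑ α_k(s) P^k` (`compSeries`) and let `A_k` be the `k`-th iterate of `F` at
`t(1+X)` (`genSeries`). The branching property (`setLIntegral_add`) turns the numerator into `𝔼[1_Λ
s^{M_n} [X^ℓ] A_k^{Z_n}]` and the denominator into `[X^ℓ] A_{n+k}`. By dominated convergence it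
suffices to find, for each `z`, the limit of `[X^ℓ] A_k^z / [X^ℓ] A_{n+k}`, with a bound uniform in
`z` (`penalizationLimit_of_tendsto`).

As `s < 1` and marks occur, the weights `α_k(s)` have mass less than one. Hence `f_s` contracts
`[0,1]` towards its fixed point `κ < 1`, the constant terms of the `A_k`, which are the iterates of
`f_s` at `t`, converge to `κ`, and for `κ > 0` the case `ℓ = 0` follows.

For `ℓ ≥ 1` and `γ = f_s'(κ) > 0`, expand `F` around the constant term of `A_k`. The nonconstant
coefficients decay at every rate above `γ`. The nonlinear terms are products of at least two of
them, so they decay at a rate `δ² < γ` and are negligible against `[X^ℓ] A_k`. The linear part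
yields the limit `z κ^{z-1} / γ^n`. With `κ = 0` and `γ = α_1(s)` this also covers `r = 1`.

For `r ≥ 2`, `γ = 0` and the decay is faster than geometric. Almost surely `Z_n ≥ r^n`, so one
normalises by `[X^ℓ] A_k^{r^n}`. The coefficients of `A_k` up to degree `ℓ` are eventually
nondecreasing in the degree, so each further factor `A_k` makes the ratio tend to `0`, and only `Z_n
= r^n` survives. The same argument settles `r = 1`, `ℓ = 0`. -/

/-! ### Measurability of generations and counts, and dependence on the past coordinates. -/

theorem measurable_ncard_of_finite {α β : Type*} [MeasurableSpace α] [Countable β]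
    {A : α → Set β} (hA : ∀ b, MeasurableSet {a | b ∈ A a}) (hfin : ∀ a, (A a).Finite) :
    Measurable fun a => (A a).ncard := by
  refine measurable_to_countable' fun k => ?_
  -- A countable type has countably many finite subsets, so this union is countable.
  have h : (fun a => (A a).ncard) ⁻¹' {k} =
      ⋃ S : {S : Finset β // S.card = k}, {a | A a = (S : Finset β)} := by
    ext a
    simp only [mem_preimage, mem_singleton_iff, mem_iUnion, mem_ofPred_eq]
    constructor
    · intro h
      exact ⟨⟨(hfin a).toFinset, by rw [← h, ncard_eq_toFinset_card _ (hfin a)]⟩, by simp⟩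
    · rintro ⟨⟨S, hS⟩, h⟩
      rw [h, ncard_coe_finset, hS]
  rw [h]
  refine MeasurableSet.iUnion fun S => ?_
  have h2 : {a | A a = (S : Finset β)} = ⋂ b, {a | b ∈ A a ↔ b ∈ (S : Finset β)} := by
    ext a
    simp [Set.ext_iff]
  rw [h2]
  exact MeasurableSet.iInter fun b => (hA b).iff (MeasurableSet.const _)

namespace MarkedTree

theorem finite_generation (τ : MarkedTree) (n : ℕ) :
    {u | u ∈ τ.nodes ∧ u.length = n}.Finite := by
  induction n with
  | zero =>
    refine (Set.finite_singleton ([] : List ℕ+)).subset ?_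
    rintro u ⟨-, hu⟩
    exact List.length_eq_zero_iff.1 hu
  | succ n ih =>
    have hfin : ∀ v ∈ {u | u ∈ τ.nodes ∧ u.length = n},
        ((fun i : ℕ+ => i :: v) '' {i | i :: v ∈ τ.nodes}).Finite := by
      rintro v ⟨hv, -⟩
      obtain ⟨k, hk⟩ := τ.exists_children v hv
      refine Set.Finite.image _ ?_
      have : {i : ℕ+ | i :: v ∈ τ.nodes} = (fun i : ℕ+ => (i : ℕ)) ⁻¹' Set.Iic k := by
        ext i
        simp [hk]
      rw [this]
      exact (Set.finite_Iic k).preimage PNat.coe_injective.injOn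
    refine (ih.biUnion hfin).subset ?_
    rintro (_ | ⟨i, v⟩) ⟨hu, hl⟩
    · simp at hl
    · simp only [mem_iUnion]
      exact ⟨v, ⟨τ.parent_mem v i hu, by simpa using hl⟩, i, hu, rfl⟩

theorem finite_marked (τ : MarkedTree) (n : ℕ) :
    {u | u ∈ τ.marked ∧ u.length < n}.Finite := by
  refine ((Set.finite_Iio n).biUnion fun m _ => τ.finite_generation m).subset ?_
  rintro u ⟨hu, hl⟩
  simp only [mem_iUnion]
  exact ⟨u.length, hl, τ.marked_subset hu, rfl⟩

/-- The vertices of generation `n`, as a finite set. -/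
noncomputable def generation (n : ℕ) (τ : MarkedTree) : Finset (List ℕ+) :=
  (τ.finite_generation n).toFinset

@[simp]
theorem mem_generation {n : ℕ} {τ : MarkedTree} {u : List ℕ+} :
    u ∈ generation n τ ↔ u ∈ τ.nodes ∧ u.length = n := by
  simp [generation]

theorem card_generation (n : ℕ) (τ : MarkedTree) : (generation n τ).card = τ.Z n :=
  (ncard_eq_toFinset_card _ (τ.finite_generation n)).symm

theorem measurable_Z (n : ℕ) : Measurable (Z n) :=
  measurable_ncard_of_finite
    (fun u => (measurableSet_mem_nodes u).inter (MeasurableSet.const (u.length = n)))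
    (fun τ => τ.finite_generation n)

theorem measurable_M (n : ℕ) : Measurable (M n) :=
  measurable_ncard_of_finite
    (fun u => (measurableSet_mem_marked u).inter (MeasurableSet.const (u.length < n)))
    (fun τ => τ.finite_marked n)

theorem measurableSet_generation_eq (n : ℕ) (S : Finset (List ℕ+)) :
    MeasurableSet {τ | generation n τ = S} := by
  have h : {τ | generation n τ = S} =
      ⋂ u, {τ : MarkedTree | (u ∈ τ.nodes ∧ u.length = n) ↔ u ∈ S} := by
    ext τ
    simp [Finset.ext_iff]
  rw [h]
  exact MeasurableSet.iInter fun u =>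
    ((measurableSet_mem_nodes u).inter (MeasurableSet.const _)).iff (MeasurableSet.const _)

theorem generation_restrict (n : ℕ) (τ : MarkedTree) :
    generation n (restrict n τ) = generation n τ := by
  ext u
  simp only [mem_generation, restrict, mem_ofPred_eq]
  constructor
  · exact fun h => ⟨h.1.1, h.2⟩
  · exact fun h => ⟨⟨h.1, h.2.le⟩, h.2⟩

theorem Z_restrict (n : ℕ) (τ : MarkedTree) : (restrict n τ).Z n = τ.Z n := by
  rw [← card_generation, generation_restrict, card_generation]

theorem M_restrict (n : ℕ) (τ : MarkedTree) : (restrict n τ).M n = τ.M n := by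
  unfold M
  congr 1
  ext u
  simp only [restrict, mem_ofPred_eq]
  tauto

theorem measurable_filtration_restrict (n : ℕ) : Measurable[filtration n] (restrict n) :=
  comap_measurable _

theorem measurable_filtration_Z (n : ℕ) : Measurable[filtration n] (Z n) := by
  have h : Z n = Z n ∘ restrict n := funext fun τ => (Z_restrict n τ).symm
  rw [h]
  exact (measurable_Z n).comp (measurable_filtration_restrict n)

theorem measurable_filtration_M (n : ℕ) : Measurable[filtration n] (M n) := by
  have h : M n = M n ∘ restrict n := funext fun τ => (M_restrict n τ).symm
  rw [h]
  exact (measurable_M n).comp (measurable_filtration_restrict n)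

theorem Z_zero (τ : MarkedTree) : τ.Z 0 = 1 := by
  have : {u | u ∈ τ.nodes ∧ u.length = 0} = {[]} := by
    ext u
    simp only [List.length_eq_zero_iff, mem_ofPred_eq, mem_singleton_iff]
    exact ⟨fun h => h.2, fun h => ⟨h ▸ τ.root_mem, h⟩⟩
  rw [Z, this, ncard_singleton]

theorem M_zero (τ : MarkedTree) : τ.M 0 = 0 := by
  simp [M]

theorem generation_succ (ξ : List ℕ+ → ℕ × Bool) (n : ℕ) :
    generation (n + 1) (ofFamily ξ) = (generation n (ofFamily ξ)).biUnion fun u =>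
      (Finset.range (ξ u).1).image fun i => i.succPNat :: u := by
  ext w
  simp only [mem_generation, Finset.mem_biUnion, Finset.mem_image, Finset.mem_range]
  constructor
  · rintro ⟨hw, hl⟩
    rcases w with _ | ⟨i, u⟩
    · simp at hl
    · refine ⟨u, ⟨hw.1, by simpa using hl⟩, i.natPred, ?_, by simp⟩
      have := hw.2
      have := i.natPred_add_one
      omega
  · rintro ⟨u, ⟨hu, hl⟩, i, hi, rfl⟩
    exact ⟨⟨hu, hi⟩, by simp [hl]⟩

theorem Z_succ (ξ : List ℕ+ → ℕ × Bool) (n : ℕ) :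
    (ofFamily ξ).Z (n + 1) = ∑ u ∈ generation n (ofFamily ξ), (ξ u).1 := by
  rw [← card_generation, generation_succ, Finset.card_biUnion]
  · refine Finset.sum_congr rfl fun u _ => ?_
    rw [Finset.card_image_of_injective, Finset.card_range]
    intro i j h
    simpa using h
  · intro u _ v _ huv
    rw [Function.onFun, Finset.disjoint_left]
    intro w hw hw'
    simp only [Finset.mem_image] at hw hw'
    obtain ⟨i, -, rfl⟩ := hw
    obtain ⟨j, -, h⟩ := hw'
    exact huv (List.cons.inj h).2.symm

theorem M_succ (ξ : List ℕ+ → ℕ × Bool) (n : ℕ) :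
    (ofFamily ξ).M (n + 1) =
      (ofFamily ξ).M n + ∑ u ∈ generation n (ofFamily ξ), if (ξ u).2 then 1 else 0 := by
  set τ := ofFamily ξ
  have h : {u | u ∈ τ.marked ∧ u.length < n + 1} =
      {u | u ∈ τ.marked ∧ u.length < n} ∪
        ↑((generation n τ).filter fun u => (ξ u).2 = true) := by
    ext u
    simp only [mem_ofPred_eq, mem_union, Finset.coe_filter, mem_generation]
    have hm : u ∈ τ.marked ↔ u ∈ τ.nodes ∧ (ξ u).2 = true := Iff.rfl
    have : u.length < n + 1 ↔ u.length < n ∨ u.length = n := by omega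
    rw [this]
    tauto
  rw [M, h, ncard_union_eq _ (τ.finite_marked n) (Finset.finite_toSet _), ncard_coe_finset,
    Finset.card_filter, M]
  rw [Set.disjoint_left]
  rintro u ⟨-, hu⟩ hu'
  simp only [Finset.coe_filter, mem_generation, mem_ofPred_eq] at hu'
  omega

/-- The σ-algebra generated by the coordinates of index of length less than `n`. -/
@[reducible]
def pastSigma (n : ℕ) : MeasurableSpace (List ℕ+ → ℕ × Bool) :=
  ⨆ u ∈ {u : List ℕ+ | u.length < n},
    MeasurableSpace.comap (fun ξ : List ℕ+ → ℕ × Bool => ξ u) inferInstance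

theorem measurable_pastSigma_eval {n : ℕ} {u : List ℕ+} (hu : u.length < n) :
    Measurable[pastSigma n] fun ξ : List ℕ+ → ℕ × Bool => ξ u :=
  Measurable.of_comap_le (le_iSup₂_of_le u hu le_rfl)

theorem measurableSet_pastSigma_reached {n : ℕ} {u : List ℕ+} (hu : u.length ≤ n) :
    MeasurableSet[pastSigma n] {ξ : List ℕ+ → ℕ × Bool | Reached ξ u} := by
  induction u with
  | nil => exact @MeasurableSet.univ _ (pastSigma n)
  | cons i u ih =>
    have hl : u.length < n := hu
    refine @MeasurableSet.inter _ (pastSigma n) _ _ (ih hl.le) ?_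
    exact (measurable_fst.comp (measurable_pastSigma_eval hl)) (measurableSet_Ici (a := (i : ℕ)))

/-- Reaching a word depends only on the child counts of its strict ancestors, so events of `𝓕 n`
read only coordinates of length less than `n`. This is how the independence of the coordinates
becomes independence of generation `n` from its past. -/
theorem measurable_pastSigma_restrict_ofFamily (n : ℕ) :
    Measurable[pastSigma n] fun ξ => restrict n (ofFamily ξ) := by
  refine @measurable_generateFrom _ _ (pastSigma n) _ _ ?_
  rintro A (⟨u, rfl⟩ | ⟨u, rfl⟩)
  · by_cases hu : u.length ≤ n
    · convert measurableSet_pastSigma_reached hu using 1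
      ext ξ
      exact ⟨fun h => h.1, fun h => ⟨h, hu⟩⟩
    · convert @MeasurableSet.empty _ (pastSigma n) using 1
      ext ξ
      simp [restrict, hu]
  · by_cases hu : u.length < n
    · have hm : MeasurableSet[pastSigma n] ({ξ | (ξ u).2 = true}) :=
        (measurable_snd.comp (measurable_pastSigma_eval hu)) (measurableSet_singleton true)
      convert @MeasurableSet.inter _ (pastSigma n) _ _ (measurableSet_pastSigma_reached hu.le) hm
        using 1
      ext ξ
      exact ⟨fun h => h.1, fun h => ⟨h, hu⟩⟩
    · convert @MeasurableSet.empty _ (pastSigma n) using 1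
      ext ξ
      simp [restrict, hu]

theorem measurableSet_pastSigma_preimage {n : ℕ} {Λ : Set MarkedTree}
    (hΛ : MeasurableSet[filtration n] Λ) : MeasurableSet[pastSigma n] (ofFamily ⁻¹' Λ) := by
  obtain ⟨B, hB, rfl⟩ := hΛ
  exact measurable_pastSigma_restrict_ofFamily n hB

theorem measurableSet_filtration_generation_eq (n : ℕ) (S : Finset (List ℕ+)) :
    MeasurableSet[filtration n] {τ | generation n τ = S} := by
  refine ⟨{τ | generation n τ = S}, measurableSet_generation_eq n S, ?_⟩
  ext τ
  simp [generation_restrict]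

theorem measurable_pastSigma_M (n : ℕ) :
    Measurable[pastSigma n] fun ξ => (ofFamily ξ).M n := by
  have h : (fun ξ => (ofFamily ξ).M n) = fun ξ => M n (restrict n (ofFamily ξ)) :=
    funext fun ξ => (M_restrict n _).symm
  rw [h]
  exact (measurable_M n).comp (measurable_pastSigma_restrict_ofFamily n)

end MarkedTree

/-! ### The branching property for power series. -/

/-- The series `∑ α_k P ^ k`, coefficientwise. -/
noncomputable def compSeries {R : Type*} [CommSemiring R] [TopologicalSpace R] (α : ℕ → R)
    (P : PowerSeries R) : PowerSeries R :=
  PowerSeries.mk fun j => ∑' k, α k * PowerSeries.coeff j (P ^ k)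

theorem coeff_compSeries {R : Type*} [CommSemiring R] [TopologicalSpace R] (α : ℕ → R)
    (P : PowerSeries R) (j : ℕ) :
    PowerSeries.coeff j (compSeries α P) = ∑' k, α k * PowerSeries.coeff j (P ^ k) :=
  PowerSeries.coeff_mk _ _

/-- The law of the family of pairs (number of children, mark). -/
noncomputable def familyLaw (p : PMF ℕ) (q : ℕ → unitInterval) :
    Measure (List ℕ+ → ℕ × Bool) :=
  Measure.infinitePi fun _ : List ℕ+ => (markingLaw p q).toMeasure

instance (p : PMF ℕ) (q : ℕ → unitInterval) : IsProbabilityMeasure (familyLaw p q) := by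
  unfold familyLaw
  infer_instance

theorem mgwLaw_eq_map (p : PMF ℕ) (q : ℕ → unitInterval) :
    mgwLaw p q = (familyLaw p q).map MarkedTree.ofFamily := rfl

theorem map_eval_familyLaw (p : PMF ℕ) (q : ℕ → unitInterval) (u : List ℕ+) :
    (familyLaw p q).map (fun ξ => ξ u) = (markingLaw p q).toMeasure :=
  Measure.infinitePi_map_eval _ u

theorem iIndepFun_familyLaw (p : PMF ℕ) (q : ℕ → unitInterval) :
    iIndepFun (fun (u : List ℕ+) (ξ : List ℕ+ → ℕ × Bool) => ξ u) (familyLaw p q) :=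
  iIndepFun_infinitePi (P := fun _ : List ℕ+ => (markingLaw p q).toMeasure)
    (X := fun _ x => x) fun _ => measurable_id

/-- `α_k = p(k) (s q(k) + 1 - q(k))` in extended nonnegative reals. -/
noncomputable def ealpha (p : PMF ℕ) (q : ℕ → unitInterval) (s : ENNReal) (k : ℕ) : ENNReal :=
  p k * (ENNReal.ofReal (1 - q k) + ENNReal.ofReal (q k) * s)

theorem lintegral_markingLaw (p : PMF ℕ) (q : ℕ → unitInterval) (g : ℕ × Bool → ENNReal) :
    ∫⁻ x, g x ∂(markingLaw p q).toMeasure =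
      ∑' k, p k * (ENNReal.ofReal (1 - q k) * g (k, false) +
        ENNReal.ofReal (q k) * g (k, true)) := by
  rw [lintegral_countable', ENNReal.tsum_prod']
  refine tsum_congr fun k => ?_
  simp_rw [PMF.toMeasure_apply_singleton _ _ (measurableSet_singleton _)]
  rw [tsum_bool]
  have h (b : Bool) : markingLaw p q (k, b) =
    p k * ENNReal.ofReal (if b then (q k : ℝ) else 1 - (q k : ℝ)) := rfl
  rw [h, h]
  simp only [Bool.false_eq_true, if_false, if_true]
  ring

/-- One vertex averages `s^{mark} P^{children}` to `∑ α_k P^k`. Working coefficientwise in `ENNReal`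
makes every exchange of sum and integral free of integrability conditions. -/
theorem lintegral_vertex (p : PMF ℕ) (q : ℕ → unitInterval) (s : ENNReal)
    (P : PowerSeries ENNReal) (u : List ℕ+) (j : ℕ) :
    ∫⁻ ξ, PowerSeries.coeff j (PowerSeries.C (s ^ (if (ξ u).2 then 1 else 0)) * P ^ (ξ u).1)
      ∂(familyLaw p q) = PowerSeries.coeff j (compSeries (ealpha p q s) P) := by
  set g : ℕ × Bool → ENNReal := fun x =>
    PowerSeries.coeff j (PowerSeries.C (s ^ (if x.2 then 1 else 0)) * P ^ x.1) with hg
  have h1 : ∫⁻ ξ, g (ξ u) ∂(familyLaw p q) = ∫⁻ x, g x ∂(markingLaw p q).toMeasure := by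
    rw [← map_eval_familyLaw p q u, lintegral_map (measurable_of_countable g)
      (measurable_pi_apply u)]
  refine h1.trans ?_
  rw [lintegral_markingLaw, coeff_compSeries]
  refine tsum_congr fun k => ?_
  simp only [hg, ealpha, PowerSeries.coeff_C_mul, Bool.false_eq_true, if_false, if_true, pow_zero,
    pow_one]
  ring

/-- A coefficient of a product is a finite sum, over the ways of splitting the degree `j`, of
products of functions of distinct coordinates; independence factorises each of them. -/
theorem lintegral_prod_vertex (p : PMF ℕ) (q : ℕ → unitInterval) (s : ENNReal)
    (P : PowerSeries ENNReal) (S : Finset (List ℕ+)) (j : ℕ) :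
    ∫⁻ ξ, PowerSeries.coeff j
        (∏ u ∈ S, (PowerSeries.C (s ^ (if (ξ u).2 then 1 else 0)) * P ^ (ξ u).1))
      ∂(familyLaw p q) = PowerSeries.coeff j (compSeries (ealpha p q s) P ^ S.card) := by
  classical
  have hm (i : ℕ) : Measurable fun x : ℕ × Bool =>
      PowerSeries.coeff i (PowerSeries.C (s ^ (if x.2 then 1 else 0)) * P ^ x.1) :=
    measurable_of_countable _
  rw [← Finset.prod_const, PowerSeries.coeff_prod]
  simp_rw [PowerSeries.coeff_prod]
  rw [lintegral_finsetSum]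
  · refine Finset.sum_congr rfl fun l _ => ?_
    rw [lintegral_prod_eq_prod_lintegral_of_indepFun S
      (fun (u : List ℕ+) (ξ : List ℕ+ → ℕ × Bool) => PowerSeries.coeff (l u)
        (PowerSeries.C (s ^ (if (ξ u).2 then 1 else 0)) * P ^ (ξ u).1))]
    · exact Finset.prod_congr rfl fun u _ => lintegral_vertex p q s P u (l u)
    · exact (iIndepFun_familyLaw p q).comp _ fun u => hm (l u)
    · exact fun u => (hm (l u)).comp (measurable_pi_apply u)
  · exact fun l _ => Finset.measurable_prod _ fun u _ => (hm (l u)).comp (measurable_pi_apply u)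

namespace MarkedTree

theorem pow_M_mul_pow_Z_succ (s : ENNReal) (P : PowerSeries ENNReal) (ξ : List ℕ+ → ℕ × Bool)
    (m j : ℕ) :
    s ^ (ofFamily ξ).M (m + 1) * PowerSeries.coeff j (P ^ (ofFamily ξ).Z (m + 1)) =
      s ^ (ofFamily ξ).M m * PowerSeries.coeff j (∏ u ∈ generation m (ofFamily ξ),
        (PowerSeries.C (s ^ (if (ξ u).2 then 1 else 0)) * P ^ (ξ u).1)) := by
  rw [Finset.prod_mul_distrib, ← map_prod, Finset.prod_pow_eq_pow_sum, Finset.prod_pow_eq_pow_sum,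
    PowerSeries.coeff_C_mul, ← Z_succ, ← mul_assoc, ← pow_add, ← M_succ]

theorem indep_pastSigma (p : PMF ℕ) (q : ℕ → unitInterval) (n : ℕ) :
    Indep (pastSigma n) (⨆ u ∈ {u : List ℕ+ | u.length = n},
      MeasurableSpace.comap (fun ξ : List ℕ+ → ℕ × Bool => ξ u) inferInstance)
      (familyLaw p q) := by
  refine indep_iSup_of_disjoint (fun u => (measurable_pi_apply u).comap_le)
    (iIndepFun_familyLaw p q) ?_
  rw [Set.disjoint_left]
  intro u hu hu'
  exact (ne_of_lt hu) hu'

theorem pastSigma_le (n : ℕ) :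
    pastSigma n ≤ (inferInstance : MeasurableSpace (List ℕ+ → ℕ × Bool)) :=
  iSup₂_le fun u _ => (measurable_pi_apply u).comap_le

/-- One step of the branching property. -/
theorem setLIntegral_succ (p : PMF ℕ) (q : ℕ → unitInterval) (s : ENNReal)
    (P : PowerSeries ENNReal) (m j : ℕ) {Λ : Set MarkedTree} (hΛ : MeasurableSet[filtration m] Λ) :
    ∫⁻ τ in Λ, s ^ τ.M (m + 1) * PowerSeries.coeff j (P ^ τ.Z (m + 1)) ∂(mgwLaw p q) =
      ∫⁻ τ in Λ, s ^ τ.M m * PowerSeries.coeff j (compSeries (ealpha p q s) P ^ τ.Z m)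
        ∂(mgwLaw p q) := by
  have hmeas (n : ℕ) (Q : PowerSeries ENNReal) :
      Measurable fun τ : MarkedTree => s ^ τ.M n * PowerSeries.coeff j (Q ^ τ.Z n) :=
    ((measurable_of_countable fun k : ℕ => s ^ k).comp (measurable_M n)).mul
      ((measurable_of_countable fun k : ℕ => PowerSeries.coeff j (Q ^ k)).comp (measurable_Z n))
  have hΛ' : MeasurableSet Λ := (filtration.le m) _ hΛ
  rw [mgwLaw_eq_map, setLIntegral_map hΛ' (hmeas _ _) measurable_ofFamily,
    setLIntegral_map hΛ' (hmeas _ _) measurable_ofFamily]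
  -- Splitting over the countably many possible values `S` of generation `m` replaces a product over
  -- a random set of vertices by a product over a fixed one.
  set E : Finset (List ℕ+) → Set (List ℕ+ → ℕ × Bool) := fun S =>
    ofFamily ⁻¹' (Λ ∩ {τ | generation m τ = S}) with hE
  have hEm (S) : MeasurableSet[pastSigma m] (E S) :=
    measurableSet_pastSigma_preimage
      (@MeasurableSet.inter _ (filtration m) _ _ hΛ (measurableSet_filtration_generation_eq m S))
  have hU : ofFamily ⁻¹' Λ = ⋃ S, E S := by
    ext ξ
    simp [hE]
  have hd : Pairwise (Function.onFun Disjoint E) := by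
    intro S T hST
    rw [Function.onFun, Set.disjoint_left]
    rintro ξ ⟨-, h⟩ ⟨-, h'⟩
    exact hST (h.symm.trans h')
  rw [hU, lintegral_iUnion (fun S => pastSigma_le m _ (hEm S)) hd,
    lintegral_iUnion (fun S => pastSigma_le m _ (hEm S)) hd]
  refine tsum_congr fun S => ?_
  by_cases hS : ∀ u ∈ S, u.length = m
  swap
  · have : E S = ∅ := by
      ext ξ
      simp only [mem_empty_iff_false, iff_false]
      rintro ⟨-, h⟩
      refine hS fun u hu => ?_
      rw [← (show generation m (ofFamily ξ) = S from h)] at hu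
      exact (mem_generation.1 hu).2
    simp [this]
  have hES := pastSigma_le m _ (hEm S)
  rw [← lintegral_indicator hES, ← lintegral_indicator hES]
  have h1 (ξ : List ℕ+ → ℕ × Bool) : (E S).indicator (fun ξ => s ^ (ofFamily ξ).M (m + 1) *
      PowerSeries.coeff j (P ^ (ofFamily ξ).Z (m + 1))) ξ =
      (E S).indicator (fun ξ => s ^ (ofFamily ξ).M m) ξ * PowerSeries.coeff j
        (∏ u ∈ S, (PowerSeries.C (s ^ (if (ξ u).2 then 1 else 0)) * P ^ (ξ u).1)) := by
    by_cases hξ : ξ ∈ E S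
    · rw [indicator_of_mem hξ, indicator_of_mem hξ, pow_M_mul_pow_Z_succ,
        show generation m (ofFamily ξ) = S from hξ.2]
    · rw [indicator_of_notMem hξ, indicator_of_notMem hξ, zero_mul]
  have h2 (ξ : List ℕ+ → ℕ × Bool) : (E S).indicator (fun ξ => s ^ (ofFamily ξ).M m *
      PowerSeries.coeff j (compSeries (ealpha p q s) P ^ (ofFamily ξ).Z m)) ξ =
      (E S).indicator (fun ξ => s ^ (ofFamily ξ).M m) ξ *
        PowerSeries.coeff j (compSeries (ealpha p q s) P ^ S.card) := by
    by_cases hξ : ξ ∈ E S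
    · rw [indicator_of_mem hξ, indicator_of_mem hξ, ← card_generation,
        show generation m (ofFamily ξ) = S from hξ.2]
    · rw [indicator_of_notMem hξ, indicator_of_notMem hξ, zero_mul]
  have hpast : Measurable[pastSigma m] ((E S).indicator fun ξ => s ^ (ofFamily ξ).M m) :=
    (((measurable_of_countable fun k : ℕ => s ^ k).comp (measurable_pastSigma_M m))).indicator
      (hEm S)
  have hle : (⨆ u ∈ {u : List ℕ+ | u.length = m},
      MeasurableSpace.comap (fun ξ : List ℕ+ → ℕ × Bool => ξ u) inferInstance) ≤
      (inferInstance : MeasurableSpace (List ℕ+ → ℕ × Bool)) :=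
    iSup₂_le fun u _ => (measurable_pi_apply u).comap_le
  have hnow : Measurable[⨆ u ∈ {u : List ℕ+ | u.length = m},
      MeasurableSpace.comap (fun ξ : List ℕ+ → ℕ × Bool => ξ u) inferInstance]
      fun ξ : List ℕ+ → ℕ × Bool => PowerSeries.coeff j
        (∏ u ∈ S, (PowerSeries.C (s ^ (if (ξ u).2 then 1 else 0)) * P ^ (ξ u).1)) := by
    classical
    simp_rw [PowerSeries.coeff_prod]
    refine Finset.measurable_sum _ fun l _ => Finset.measurable_prod _ fun u hu => ?_
    exact (measurable_of_countable fun x : ℕ × Bool => PowerSeries.coeff (l u)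
      (PowerSeries.C (s ^ (if x.2 then 1 else 0)) * P ^ x.1)).comp
        (Measurable.of_comap_le (le_iSup₂_of_le u (hS u hu) le_rfl))
  simp_rw [h1, h2]
  -- The first factor depends on words shorter than `m`, the second on words of length exactly `m`.
  rw [lintegral_mul_eq_lintegral_mul_lintegral_of_independent_measurableSpace (pastSigma_le m) hle
    (indep_pastSigma p q m) hpast hnow, lintegral_prod_vertex,
    lintegral_mul_const _ (hpast.mono (pastSigma_le m) le_rfl)]

/-- The branching property. -/
theorem setLIntegral_add (p : PMF ℕ) (q : ℕ → unitInterval) (s : ENNReal)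
    (P : PowerSeries ENNReal) (n k j : ℕ) {Λ : Set MarkedTree}
    (hΛ : MeasurableSet[filtration n] Λ) :
    ∫⁻ τ in Λ, s ^ τ.M (n + k) * PowerSeries.coeff j (P ^ τ.Z (n + k)) ∂(mgwLaw p q) =
      ∫⁻ τ in Λ, s ^ τ.M n * PowerSeries.coeff j ((compSeries (ealpha p q s))^[k] P ^ τ.Z n)
        ∂(mgwLaw p q) := by
  induction k generalizing P with
  | zero => rfl
  | succ k ih =>
    rw [Function.iterate_succ_apply, ← ih, ← add_assoc,
      setLIntegral_succ p q s P (n + k) j (filtration.mono (Nat.le_add_right n k) _ hΛ)]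

theorem lintegral_eq_coeff (p : PMF ℕ) (q : ℕ → unitInterval) (s : ENNReal)
    (P : PowerSeries ENNReal) (k j : ℕ) :
    ∫⁻ τ, s ^ τ.M k * PowerSeries.coeff j (P ^ τ.Z k) ∂(mgwLaw p q) =
      PowerSeries.coeff j ((compSeries (ealpha p q s))^[k] P) := by
  have h := setLIntegral_add p q s P 0 k j (Λ := Set.univ) (@MeasurableSet.univ _ (filtration 0))
  simpa [Z_zero, M_zero] using h

/-- Limits and bounds are needed only for `z ≥ r^n`. This matters when `κ = 0`, where smaller powers
of a vanishing series are not controlled by the power `r^n`. -/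
theorem ae_minOffspring_pow_le_Z (p : PMF ℕ) (q : ℕ → unitInterval) (n : ℕ) :
    ∀ᵐ τ ∂(mgwLaw p q), minOffspring p ^ n ≤ τ.Z n := by
  rw [mgwLaw_eq_map, ae_map_iff measurable_ofFamily.aemeasurable
    (measurableSet_le measurable_const (measurable_Z n))]
  have h : ∀ᵐ ξ ∂(familyLaw p q), ∀ u, minOffspring p ≤ (ξ u).1 := by
    rw [ae_all_iff]
    intro u
    have h1 : ∀ᵐ x ∂(familyLaw p q).map (fun ξ => ξ u), minOffspring p ≤ x.1 := by
      rw [map_eval_familyLaw, ae_iff, PMF.toMeasure_apply_eq_zero_iff _ (by measurability),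
        Set.disjoint_left]
      rintro ⟨k, b⟩ hx hk
      refine hk (Nat.sInf_le ?_)
      rw [PMF.mem_support_iff] at hx
      exact pos_iff_ne_zero.2 (left_ne_zero_of_mul hx)
    exact ae_of_ae_map (measurable_pi_apply u).aemeasurable h1
  filter_upwards [h] with ξ hξ
  induction n with
  | zero => simp [Z_zero]
  | succ n ih =>
    rw [Z_succ, pow_succ]
    calc minOffspring p ^ n * minOffspring p
        ≤ (ofFamily ξ).Z n * minOffspring p := Nat.mul_le_mul_right _ ih
      _ = ∑ u ∈ generation n (ofFamily ξ), minOffspring p := by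
          rw [Finset.sum_const, card_generation, smul_eq_mul]
      _ ≤ _ := Finset.sum_le_sum fun u _ => hξ u

end MarkedTree

/-! ### Bounds on powers and on coefficients of powers. -/

/-- For `k ≥ i` these are dominated by terms of the convergent series `∑ C(m+i, i) b^m`. The
uniformity in `k` serves twice: it dominates the derivatives of `f_s` and gives bounds independent
of the population size. -/
theorem exists_choose_mul_pow_le (i : ℕ) {b : ℝ} (hb0 : 0 ≤ b) (hb : b < 1) :
    ∃ K : ℝ, 0 ≤ K ∧ ∀ (k : ℕ) (a : ℝ), 0 ≤ a → a ≤ b → (k.choose i : ℝ) * a ^ (k - i) ≤ K := by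
  have hs := summable_choose_mul_geometric_of_norm_lt_one i (r := b)
    (by rwa [Real.norm_of_nonneg hb0])
  have hn : ∀ m : ℕ, 0 ≤ ((m + i).choose i : ℝ) * b ^ m := fun m => by positivity
  refine ⟨∑' m : ℕ, ((m + i).choose i : ℝ) * b ^ m, tsum_nonneg hn, fun k a ha hab => ?_⟩
  rcases lt_or_ge k i with h | h
  · rw [Nat.choose_eq_zero_of_lt h]
    simpa using tsum_nonneg hn
  · obtain ⟨m, rfl⟩ := Nat.exists_eq_add_of_le' h
    rw [Nat.add_sub_cancel]
    calc ((m + i).choose i : ℝ) * a ^ m ≤ ((m + i).choose i : ℝ) * b ^ m := by gcongr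
      _ ≤ _ := hs.le_tsum m fun m _ => hn m

/-- Factor out `x - y`, bound the powers of `x` in the remaining sum by `1`, and sum the geometric
series in `y`. -/
theorem abs_pow_sub_pow_mul_le {x y : ℝ} (hx0 : 0 ≤ x) (hx1 : x ≤ 1) (hy0 : 0 ≤ y) (hy1 : y ≤ 1)
    (k : ℕ) : |x ^ k - y ^ k| * (1 - y) ≤ |x - y| * (1 - y ^ k) := by
  have hgeom : (∑ i ∈ Finset.range k, y ^ (k - 1 - i)) * (1 - y) = 1 - y ^ k := by
    have := geom_sum₂_mul (1 : ℝ) y k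
    simpa using this
  have hle : ∑ i ∈ Finset.range k, x ^ i * y ^ (k - 1 - i) ≤
      ∑ i ∈ Finset.range k, y ^ (k - 1 - i) :=
    Finset.sum_le_sum fun i _ => mul_le_of_le_one_left (pow_nonneg hy0 _) (pow_le_one₀ hx0 hx1)
  have hnn : 0 ≤ ∑ i ∈ Finset.range k, x ^ i * y ^ (k - 1 - i) :=
    Finset.sum_nonneg fun i _ => mul_nonneg (pow_nonneg hx0 _) (pow_nonneg hy0 _)
  have h := mul_le_mul_of_nonneg_right hle
    (mul_nonneg (abs_nonneg (x - y)) (sub_nonneg.2 hy1))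
  rw [← geom_sum₂_mul, abs_mul, abs_of_nonneg hnn, ← hgeom]
  linarith

namespace PowerSeries

/-- Binomial theorem around the constant term: the `i`-th power of a series without constant term
has order at least `i`, so the range of summation depends on `j` and not on `k`. -/
theorem coeff_pow_eq_sum_sub (P : PowerSeries ℝ) (j k : ℕ) :
    coeff j (P ^ k) = ∑ i ∈ Finset.range (j + 1),
      (k.choose i : ℝ) * constantCoeff P ^ (k - i) * coeff j ((P - C (constantCoeff P)) ^ i) := by
  set Q := P - C (constantCoeff P) with hQ
  have hQ0 : constantCoeff Q = 0 := by simp [hQ]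
  have hP : P = Q + C (constantCoeff P) := by simp [hQ]
  have hterm (i : ℕ) :
      coeff j (Q ^ i * C (constantCoeff P) ^ (k - i) * (k.choose i : PowerSeries ℝ)) =
        (k.choose i : ℝ) * constantCoeff P ^ (k - i) * coeff j (Q ^ i) := by
    have : Q ^ i * C (constantCoeff P) ^ (k - i) * (k.choose i : PowerSeries ℝ) =
        C ((k.choose i : ℝ) * constantCoeff P ^ (k - i)) * Q ^ i := by
      rw [map_mul, map_pow, map_natCast]
      ring
    rw [this, coeff_C_mul]
  have hzero (i : ℕ) (hi : j < i) : coeff j (Q ^ i) = 0 := by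
    refine coeff_of_lt_order _ (lt_of_lt_of_le ?_ (le_order_pow_of_constantCoeff_eq_zero i hQ0))
    exact_mod_cast hi
  conv_lhs => rw [hP, add_pow, map_sum]
  simp_rw [hterm]
  rcases le_total k j with h | h
  · refine Finset.sum_subset (Finset.range_mono (by omega)) fun i _ hi => ?_
    rw [Finset.mem_range, not_lt] at hi
    rw [Nat.choose_eq_zero_of_lt (by omega)]
    simp
  · symm
    refine Finset.sum_subset (Finset.range_mono (by omega)) fun i _ hi => ?_
    rw [Finset.mem_range, not_lt] at hi
    rw [hzero i (by omega), mul_zero]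

theorem coeff_pow_nonneg {P : PowerSeries ℝ} (hP : ∀ j, 0 ≤ coeff j P) (k j : ℕ) :
    0 ≤ coeff j (P ^ k) := by
  rw [coeff_pow]
  exact Finset.sum_nonneg fun l _ => Finset.prod_nonneg fun i _ => hP _

theorem coeff_sub_C_of_pos (P : PowerSeries ℝ) (a : ℝ) {j : ℕ} (hj : j ≠ 0) :
    coeff j (P - C a) = coeff j P := by
  rw [map_sub, coeff_C, if_neg hj, sub_zero]

theorem coeff_sub_constantCoeff_nonneg {P : PowerSeries ℝ} (hP : ∀ j, 0 ≤ coeff j P) (j : ℕ) :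
    0 ≤ coeff j (P - C (constantCoeff P)) := by
  rcases eq_or_ne j 0 with rfl | hj
  · simp
  · rw [coeff_sub_C_of_pos _ _ hj]
    exact hP j

/-- With at least two factors and no constant term, a nonzero contribution splits `j` into positive
parts, all smaller than `j`. Nonlinear terms thus involve only lower coefficients, which makes
induction on the degree possible. -/
theorem coeff_pow_le_of_coeff_le {Q : PowerSeries ℝ} (hQ : ∀ j, 0 ≤ coeff j Q)
    (hQ0 : constantCoeff Q = 0) {ε : ℝ} {j i : ℕ} (hi : 2 ≤ i)
    (hε0 : 0 ≤ ε) (hε : ∀ m, 1 ≤ m → m < j → coeff m Q ≤ ε) :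
    coeff j (Q ^ i) ≤ ((Finset.range i).finsuppAntidiag j).card * ε ^ i := by
  rw [coeff_pow, ← nsmul_eq_mul]
  refine Finset.sum_le_card_nsmul _ _ _ fun l hl => ?_
  rw [Finset.mem_finsuppAntidiag] at hl
  by_cases h : ∃ m ∈ Finset.range i, l m = 0
  · obtain ⟨m, hm, hm0⟩ := h
    rw [Finset.prod_eq_zero hm (by rw [hm0]; simpa using hQ0)]
    positivity
  · push Not at h
    rw [← Finset.card_range i, ← Finset.prod_const, Finset.card_range]
    refine Finset.prod_le_prod (fun m _ => hQ _) fun m hm => hε _ (Nat.pos_of_ne_zero (h m hm)) ?_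
    -- A second factor takes degree at least one, so `l m < j`.
    obtain ⟨m', hm', hne⟩ : ∃ m' ∈ Finset.range i, m' ≠ m := by
      rcases eq_or_ne m 0 with rfl | h0
      · exact ⟨1, by simp; omega, by simp⟩
      · exact ⟨0, by simp; omega, h0.symm⟩
    have h2 := Finset.sum_le_sum_of_subset (f := l) (s := {m, m'}) (t := Finset.range i)
      (by intro x hx; simp only [Finset.mem_insert, Finset.mem_singleton] at hx
          rcases hx with rfl | rfl <;> assumption)
    rw [Finset.sum_pair hne.symm] at h2
    replace h2 := h2.trans_eq hl.1
    have h4 := Nat.pos_of_ne_zero (h m' hm')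
    omega

end PowerSeries

/-! ### Defective weights and the fixed point of their generating function. -/

/-- Nonnegative weights on `ℕ` with total mass less than one. -/
structure IsDefective (α : ℕ → ℝ) : Prop where
  nonneg : ∀ k, 0 ≤ α k
  summable : Summable α
  tsum_lt_one : ∑' k, α k < 1

/-- The series `∑ α_k C(k, i) x ^ (k - i)`. -/
noncomputable def binomSum (α : ℕ → ℝ) (i : ℕ) (x : ℝ) : ℝ :=
  ∑' k, α k * ((k.choose i : ℝ) * x ^ (k - i))

theorem binomSum_zero (α : ℕ → ℝ) (x : ℝ) : binomSum α 0 x = ∑' k, α k * x ^ k := by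
  simp [binomSum]

namespace IsDefective

open PowerSeries

variable {α : ℕ → ℝ} (hα : IsDefective α)
include hα

theorem summable_binom (i : ℕ) {x : ℝ} (hx0 : 0 ≤ x) (hx : x < 1) :
    Summable fun k => α k * ((k.choose i : ℝ) * x ^ (k - i)) := by
  obtain ⟨K, -, hK⟩ := exists_choose_mul_pow_le i hx0 hx
  refine Summable.of_nonneg_of_le (fun k => mul_nonneg (hα.nonneg k) (by positivity)) (fun k => ?_)
    (hα.summable.mul_right K)
  exact mul_le_mul_of_nonneg_left (hK k x hx0 le_rfl) (hα.nonneg k)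

theorem binomSum_nonneg (i : ℕ) {x : ℝ} (hx : 0 ≤ x) : 0 ≤ binomSum α i x :=
  tsum_nonneg fun k => mul_nonneg (hα.nonneg k) (by positivity)

theorem summable_pow {x : ℝ} (hx0 : 0 ≤ x) (hx : x ≤ 1) : Summable fun k => α k * x ^ k :=
  Summable.of_nonneg_of_le (fun k => mul_nonneg (hα.nonneg k) (by positivity))
    (fun k => mul_le_of_le_one_right (hα.nonneg k) (pow_le_one₀ hx0 hx)) hα.summable

theorem binomSum_zero_le {x : ℝ} (hx0 : 0 ≤ x) (hx : x ≤ 1) : binomSum α 0 x ≤ ∑' k, α k := by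
  rw [binomSum_zero]
  exact (hα.summable_pow hx0 hx).tsum_le_tsum
    (fun k => mul_le_of_le_one_right (hα.nonneg k) (pow_le_one₀ hx0 hx)) hα.summable

theorem tendsto_binomSum (i : ℕ) {a : ℕ → ℝ} {x : ℝ} (ha0 : ∀ p, 0 ≤ a p)
    (ha : Tendsto a atTop (𝓝 x)) (hx : x < 1) :
    Tendsto (fun p => binomSum α i (a p)) atTop (𝓝 (binomSum α i x)) := by
  obtain ⟨b, hxb, hb⟩ := exists_between hx
  have hx0 : 0 ≤ x := ge_of_tendsto' ha ha0
  obtain ⟨K, -, hK⟩ := exists_choose_mul_pow_le i (hx0.trans hxb.le) hb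
  refine tendsto_tsum_of_dominated_convergence (bound := fun k => α k * K)
    (hα.summable.mul_right K) (fun k => ?_) ?_
  · exact ((ha.pow (k - i)).const_mul _).const_mul _
  · filter_upwards [ha.eventually_lt_const hxb] with p hp k
    rw [Real.norm_of_nonneg (mul_nonneg (hα.nonneg k) (mul_nonneg (by positivity)
      (pow_nonneg (ha0 p) _)))]
    exact mul_le_mul_of_nonneg_left (hK k _ (ha0 p) hp.le) (hα.nonneg k)

theorem exists_fixedPoint : ∃ κ, 0 ≤ κ ∧ κ < 1 ∧ binomSum α 0 κ = κ := by
  have hcont : ContinuousOn (binomSum α 0) (Icc 0 1) := by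
    have : binomSum α 0 = fun x => ∑' k, α k * x ^ k := funext (binomSum_zero α)
    rw [this]
    refine continuousOn_tsum (u := α) (fun k => by fun_prop) hα.summable fun k x hx => ?_
    rw [Real.norm_of_nonneg (mul_nonneg (hα.nonneg k) (pow_nonneg hx.1 k))]
    exact mul_le_of_le_one_right (hα.nonneg k) (pow_le_one₀ hx.1 hx.2)
  have h1 : binomSum α 0 1 < 1 := (hα.binomSum_zero_le zero_le_one le_rfl).trans_lt hα.tsum_lt_one
  obtain ⟨κ, hκ, h⟩ := intermediate_value_Icc' (zero_le_one' ℝ)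
    (hcont.sub continuousOn_id) (show (0 : ℝ) ∈ Icc _ _ from
      ⟨by simpa using h1.le, by simpa using hα.binomSum_nonneg 0 le_rfl⟩)
  have h : binomSum α 0 κ = κ := sub_eq_zero.1 h
  exact ⟨κ, hκ.1, lt_of_le_of_ne hκ.2 (by rintro rfl; exact h1.ne h), h⟩

/-- Contraction towards the fixed point. -/
theorem abs_binomSum_sub_le {κ : ℝ} (hκ0 : 0 ≤ κ) (hκ1 : κ < 1) (hκ : binomSum α 0 κ = κ) :
    ∃ ρ, 0 ≤ ρ ∧ ρ < 1 ∧ binomSum α 1 κ ≤ ρ ∧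
      ∀ x, 0 ≤ x → x ≤ 1 → |binomSum α 0 x - κ| ≤ ρ * |x - κ| := by
  have h1κ : 0 < 1 - κ := by linarith
  have hgeom (k : ℕ) : (∑ i ∈ Finset.range k, κ ^ (k - 1 - i)) * (1 - κ) = 1 - κ ^ k := by
    have := geom_sum₂_mul (1 : ℝ) κ k
    simpa using this
  have hs1 : Summable fun k => α k * (1 - κ ^ k) := by
    simpa [mul_sub] using hα.summable.sub (hα.summable_pow hκ0 hκ1.le)
  have hsum1 : ∑' k, α k * (1 - κ ^ k) = ∑' k, α k - κ := by
    simp_rw [mul_sub, mul_one]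
    rw [hα.summable.tsum_sub (hα.summable_pow hκ0 hκ1.le), ← binomSum_zero, hκ]
  have hnn : 0 ≤ ∑' k, α k - κ := by
    rw [← hsum1]
    exact tsum_nonneg fun k => mul_nonneg (hα.nonneg k)
      (sub_nonneg.2 (pow_le_one₀ hκ0 hκ1.le))
  -- The contraction constant is the slope of the chord of `f` between `κ` and `1`. It is below `1`
  -- because `f(1) < 1`, and above `f'(κ)` in the weak sense by convexity.
  refine ⟨(∑' k, α k - κ) / (1 - κ), by positivity, ?_, ?_, fun x hx0 hx1 => ?_⟩
  · rw [div_lt_one h1κ]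
    linarith [hα.tsum_lt_one]
  · rw [le_div_iff₀ h1κ, ← hsum1, binomSum, ← tsum_mul_right]
    refine ((hα.summable_binom 1 hκ0 hκ1).mul_right _).tsum_le_tsum (fun k => ?_) hs1
    rw [mul_assoc]
    refine mul_le_mul_of_nonneg_left ?_ (hα.nonneg k)
    rw [← hgeom k]
    refine mul_le_mul_of_nonneg_right ?_ h1κ.le
    rw [Nat.choose_one_right, ← nsmul_eq_mul]
    conv_lhs => rw [← Finset.card_range k]
    refine Finset.card_nsmul_le_sum _ _ _ fun i _ => ?_
    exact pow_le_pow_of_le_one hκ0 hκ1.le (by simp)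
  · rw [div_mul_eq_mul_div, le_div_iff₀ h1κ]
    have hsx := hα.summable_pow hx0 hx1
    have hsκ := hα.summable_pow hκ0 hκ1.le
    have habs : Summable fun k => |α k * x ^ k - α k * κ ^ k| := (hsx.sub hsκ).abs
    calc |binomSum α 0 x - κ| * (1 - κ)
        = |∑' k, (α k * x ^ k - α k * κ ^ k)| * (1 - κ) := by
          rw [hsx.tsum_sub hsκ, ← binomSum_zero, ← binomSum_zero, hκ]
      _ ≤ (∑' k, |α k * x ^ k - α k * κ ^ k|) * (1 - κ) := by
          refine mul_le_mul_of_nonneg_right ?_ h1κ.le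
          exact norm_tsum_le_tsum_norm (hsx.sub hsκ).norm
      _ = ∑' k, |α k * x ^ k - α k * κ ^ k| * (1 - κ) :=
          (tsum_mul_right (a := 1 - κ) (f := fun k => |α k * x ^ k - α k * κ ^ k|)).symm
      _ ≤ ∑' k, |x - κ| * (α k * (1 - κ ^ k)) := by
          refine (habs.mul_right _).tsum_le_tsum (fun k => ?_) (hs1.mul_left _)
          rw [← mul_sub, abs_mul, abs_of_nonneg (hα.nonneg k), mul_assoc, mul_left_comm |x - κ|]
          exact mul_le_mul_of_nonneg_left (abs_pow_sub_pow_mul_le hx0 hx1 hκ0 hκ1.le k)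
            (hα.nonneg k)
      _ = (∑' k, α k - κ) * |x - κ| := 
          (tsum_mul_left (a := |x - κ|) (f := fun k => α k * (1 - κ ^ k))).trans
            (by rw [hsum1]; exact mul_comm _ _)

theorem binomSum_one_lt_one {κ : ℝ} (hκ0 : 0 ≤ κ) (hκ1 : κ < 1) (hκ : binomSum α 0 κ = κ) :
    binomSum α 1 κ < 1 := by
  obtain ⟨ρ, -, h1, h2, -⟩ := hα.abs_binomSum_sub_le hκ0 hκ1 hκ
  exact h2.trans_lt h1

theorem eq_of_fixedPoint {κ x : ℝ} (hκ0 : 0 ≤ κ) (hκ1 : κ < 1) (hκ : binomSum α 0 κ = κ)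
    (hx0 : 0 ≤ x) (hx1 : x ≤ 1) (hx : binomSum α 0 x = x) : x = κ := by
  obtain ⟨ρ, -, h1, -, h⟩ := hα.abs_binomSum_sub_le hκ0 hκ1 hκ
  have := h x hx0 hx1
  rw [hx] at this
  have h0 : |x - κ| = 0 := by nlinarith [abs_nonneg (x - κ)]
  exact sub_eq_zero.1 (abs_eq_zero.1 h0)

/-- This is the Taylor expansion of `f` at the constant term of `P`; that term being less than `1`
makes the derivative series summable. -/
theorem coeff_compSeries_of_lt_one {P : PowerSeries ℝ} (hP0 : 0 ≤ constantCoeff P)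
    (hP1 : constantCoeff P < 1) (j : ℕ) :
    coeff j (compSeries α P) = ∑ i ∈ Finset.range (j + 1),
      binomSum α i (constantCoeff P) * coeff j ((P - C (constantCoeff P)) ^ i) := by
  rw [coeff_compSeries]
  simp_rw [coeff_pow_eq_sum_sub P j, Finset.mul_sum, ← mul_assoc]
  rw [Summable.tsum_finsetSum]
  · refine Finset.sum_congr rfl fun i _ => ?_
    rw [tsum_mul_right, binomSum]
    simp_rw [mul_assoc]
  · intro i _
    refine Summable.mul_right _ ?_
    simpa only [mul_assoc] using hα.summable_binom i hP0 hP1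

theorem summable_coeff_pow {P : PowerSeries ℝ} (hP0 : 0 ≤ constantCoeff P)
    (hP1 : constantCoeff P < 1) (j : ℕ) : Summable fun k => α k * coeff j (P ^ k) := by
  simp_rw [coeff_pow_eq_sum_sub P j, Finset.mul_sum, ← mul_assoc]
  refine summable_sum fun i _ => Summable.mul_right _ ?_
  simpa only [mul_assoc] using hα.summable_binom i hP0 hP1

end IsDefective

/-! ### The iterated generating series: summability, decay and positivity. -/

/-- The iterates of `compSeries α` started from `t (1 + X)`. -/
noncomputable def genSeries {R : Type*} [CommSemiring R] [TopologicalSpace R] (α : ℕ → R) (t : R)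
    (p : ℕ) : PowerSeries R :=
  (compSeries α)^[p] (PowerSeries.C t * (1 + PowerSeries.X))

theorem genSeries_succ {R : Type*} [CommSemiring R] [TopologicalSpace R] (α : ℕ → R) (t : R)
    (p : ℕ) : genSeries α t (p + 1) = compSeries α (genSeries α t p) :=
  Function.iterate_succ_apply' _ _ _

theorem coeff_C_mul_one_add_X_pow {R : Type*} [CommSemiring R] (t : R) (k j : ℕ) :
    PowerSeries.coeff j ((PowerSeries.C t * (1 + PowerSeries.X)) ^ k) =
      t ^ k * (k.choose j : R) := by
  have h : (1 + PowerSeries.X : PowerSeries R) ^ k = (((1 + Polynomial.X) ^ k : Polynomial R)) := by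
    simp
  rw [mul_pow, ← map_pow, PowerSeries.coeff_C_mul, h, Polynomial.coeff_coe,
    Polynomial.coeff_one_add_X_pow]

theorem coeff_genSeries_zero {R : Type*} [CommSemiring R] [TopologicalSpace R] (α : ℕ → R) (t : R)
    (j : ℕ) : PowerSeries.coeff j (genSeries α t 0) = t * (Nat.choose 1 j : R) := by
  have := coeff_C_mul_one_add_X_pow t 1 j
  simpa [genSeries] using this

/-- The value `K / (1 - θ)` is the fixed point of `x ↦ θ x + K`, so any larger bound is preserved by
the recursion. -/
theorem exists_forall_le_of_le_mul_add {u : ℕ → ℝ} {θ K : ℝ} (hθ0 : 0 ≤ θ) (hθ : θ < 1)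
    (h : ∀ᶠ p in atTop, u (p + 1) ≤ θ * u p + K) : ∃ B, ∀ p, u p ≤ B := by
  obtain ⟨p₀, hp₀⟩ := eventually_atTop.1 h
  have h1 : 0 < 1 - θ := by linarith
  have hb : ∀ p, p₀ ≤ p → u p ≤ max (u p₀) (K / (1 - θ)) := by
    intro p hp
    induction p, hp using Nat.le_induction with
    | base => exact le_max_left _ _
    | succ p hp ih =>
      have hK : K ≤ (1 - θ) * max (u p₀) (K / (1 - θ)) := by
        rw [← div_le_iff₀' h1]
        exact le_max_right _ _
      have := mul_le_mul_of_nonneg_left ih hθ0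
      linarith [hp₀ p hp]
  have hbd : IsBoundedUnder (· ≤ ·) atTop u :=
    ⟨_, eventually_map.2 (eventually_atTop.2 ⟨p₀, hb⟩)⟩
  obtain ⟨B, hB⟩ := hbd.bddAbove_range
  exact ⟨B, fun p => hB (mem_range_self p)⟩

namespace IsDefective

open PowerSeries

variable {α : ℕ → ℝ} (hα : IsDefective α)
include hα

theorem coeff_genSeries_nonneg {t : ℝ} (ht : 0 ≤ t) (p j : ℕ) : 0 ≤ coeff j (genSeries α t p) := by
  induction p generalizing j with
  | zero => rw [coeff_genSeries_zero]; positivity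
  | succ p ih =>
    rw [genSeries_succ, coeff_compSeries]
    exact tsum_nonneg fun k => mul_nonneg (hα.nonneg k) (coeff_pow_nonneg ih k j)

omit hα in
theorem constantCoeff_genSeries_succ (t : ℝ) (p : ℕ) :
    constantCoeff (genSeries α t (p + 1)) = binomSum α 0 (constantCoeff (genSeries α t p)) := by
  rw [← coeff_zero_eq_constantCoeff_apply, genSeries_succ, coeff_compSeries, binomSum_zero]
  simp

theorem constantCoeff_genSeries_nonneg {t : ℝ} (ht : 0 ≤ t) (p : ℕ) :
    0 ≤ constantCoeff (genSeries α t p) := by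
  rw [← coeff_zero_eq_constantCoeff_apply]
  exact hα.coeff_genSeries_nonneg ht p 0

theorem constantCoeff_genSeries_le_one {t : ℝ} (ht : 0 ≤ t) (ht1 : t ≤ 1) (p : ℕ) :
    constantCoeff (genSeries α t p) ≤ 1 := by
  induction p with
  | zero =>
    rw [← coeff_zero_eq_constantCoeff_apply, coeff_genSeries_zero]
    simpa using ht1
  | succ p ih =>
    rw [constantCoeff_genSeries_succ]
    exact (hα.binomSum_zero_le (hα.constantCoeff_genSeries_nonneg ht p) ih).trans
      hα.tsum_lt_one.le

theorem constantCoeff_genSeries_succ_lt_one {t : ℝ} (ht : 0 ≤ t) (ht1 : t ≤ 1) (p : ℕ) :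
    constantCoeff (genSeries α t (p + 1)) < 1 := by
  rw [constantCoeff_genSeries_succ]
  exact (hα.binomSum_zero_le (hα.constantCoeff_genSeries_nonneg ht p)
    (hα.constantCoeff_genSeries_le_one ht ht1 p)).trans_lt hα.tsum_lt_one

theorem tendsto_constantCoeff_genSeries {κ t : ℝ} (hκ0 : 0 ≤ κ) (hκ1 : κ < 1)
    (hκ : binomSum α 0 κ = κ) (ht : 0 ≤ t) (ht1 : t ≤ 1) :
    Tendsto (fun p => constantCoeff (genSeries α t p)) atTop (𝓝 κ) := by
  obtain ⟨ρ, hρ0, hρ1, -, h⟩ := hα.abs_binomSum_sub_le hκ0 hκ1 hκ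
  have hb (p : ℕ) : |constantCoeff (genSeries α t p) - κ| ≤
      ρ ^ p * |constantCoeff (genSeries α t 0) - κ| := by
    induction p with
    | zero => simp
    | succ p ih =>
      rw [constantCoeff_genSeries_succ, pow_succ', mul_assoc]
      exact (h _ (hα.constantCoeff_genSeries_nonneg ht p)
        (hα.constantCoeff_genSeries_le_one ht ht1 p)).trans (mul_le_mul_of_nonneg_left ih hρ0)
  rw [tendsto_iff_norm_sub_tendsto_zero]
  refine squeeze_zero (fun _ => norm_nonneg _) hb ?_
  simpa using (tendsto_pow_atTop_nhds_zero_of_lt_one hρ0 hρ1).mul_const _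

/-- The moment of order `ℓ` is used only at `p = 0`, where the constant term may equal `1`. After
one iteration it is less than `1` and summability is automatic. -/
theorem summable_coeff_genSeries_pow {t : ℝ} (ht : 0 ≤ t) (ht1 : t ≤ 1) {ℓ j : ℕ}
    (hℓ : Summable fun k : ℕ => (k : ℝ) ^ ℓ * α k) (hj : j ≤ ℓ) (p : ℕ) :
    Summable fun k => α k * coeff j (genSeries α t p ^ k) := by
  rcases p with _ | p
  · refine Summable.of_nonneg_of_le (fun k => mul_nonneg (hα.nonneg k)
      (coeff_pow_nonneg (hα.coeff_genSeries_nonneg ht 0) k j)) (fun k => ?_)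
      (hα.summable.add hℓ)
    have h1 : coeff j (genSeries α t 0 ^ k) = t ^ k * (k.choose j : ℝ) :=
      coeff_C_mul_one_add_X_pow t k j
    -- The added `1` covers `k = 0`, `j = 0`, where `0 ^ ℓ` vanishes for `ℓ > 0`.
    have h2 : (k.choose j : ℝ) ≤ 1 + (k : ℝ) ^ ℓ := by
      rcases Nat.eq_zero_or_pos k with rfl | hk
      · have : (Nat.choose 0 j : ℝ) ≤ 1 := by
          rcases j with _ | j <;> simp
        have : (0 : ℝ) ≤ ((0 : ℕ) : ℝ) ^ ℓ := by positivity
        linarith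
      · have h3 : k.choose j ≤ k ^ ℓ :=
          (Nat.choose_le_pow k j).trans (Nat.pow_le_pow_right hk hj)
        have : (k.choose j : ℝ) ≤ (k : ℝ) ^ ℓ := by exact_mod_cast h3
        linarith
    have h4 : t ^ k * (k.choose j : ℝ) ≤ 1 + (k : ℝ) ^ ℓ :=
      (mul_le_of_le_one_left (by positivity) (pow_le_one₀ ht ht1)).trans h2
    rw [h1]
    calc α k * (t ^ k * (k.choose j : ℝ)) ≤ α k * (1 + (k : ℝ) ^ ℓ) :=
          mul_le_mul_of_nonneg_left h4 (hα.nonneg k)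
      _ = _ := by ring
  · exact hα.summable_coeff_pow (hα.constantCoeff_genSeries_nonneg ht _)
      (hα.constantCoeff_genSeries_succ_lt_one ht ht1 p) j

/-- The recursion for the coefficients, with the linear term set apart. -/
theorem coeff_genSeries_succ_succ {t : ℝ} (ht : 0 ≤ t) (ht1 : t ≤ 1) {j : ℕ} (hj : 1 ≤ j) (p : ℕ) :
    coeff j (genSeries α t (p + 2)) =
      binomSum α 1 (constantCoeff (genSeries α t (p + 1))) * coeff j (genSeries α t (p + 1)) +
        ∑ i ∈ Finset.Ico 2 (j + 1), binomSum α i (constantCoeff (genSeries α t (p + 1))) *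
          coeff j ((genSeries α t (p + 1) - C (constantCoeff (genSeries α t (p + 1)))) ^ i) := by
  rw [show p + 2 = (p + 1) + 1 from rfl, genSeries_succ, hα.coeff_compSeries_of_lt_one
    (hα.constantCoeff_genSeries_nonneg ht _) (hα.constantCoeff_genSeries_succ_lt_one ht ht1 p),
    Finset.range_eq_Ico, Finset.sum_eq_sum_Ico_succ_bot (by omega),
    Finset.sum_eq_sum_Ico_succ_bot (by omega)]
  have h0 : coeff j (1 : PowerSeries ℝ) = 0 := by rw [coeff_one, if_neg (by omega)]
  rw [pow_zero, h0, mul_zero, zero_add, zero_add, pow_one, coeff_sub_C_of_pos _ _ (by omega)]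

/-- At least two coefficients of size `δ^p` are multiplied, so the rate is squared. -/
theorem coeff_sub_pow_le {t : ℝ} (ht : 0 ≤ t) {δ B : ℝ} (hδ0 : 0 ≤ δ)
    (hδ1 : δ ≤ 1) (hB : 0 ≤ B) {j : ℕ}
    (h : ∀ m, 1 ≤ m → m < j → ∀ p, coeff m (genSeries α t p) ≤ B * δ ^ p) {i : ℕ} (hi : 2 ≤ i)
    (p : ℕ) :
    coeff j ((genSeries α t p - C (constantCoeff (genSeries α t p))) ^ i) ≤
      ((Finset.range i).finsuppAntidiag j).card * B ^ i * (δ ^ 2) ^ p := by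
  refine (coeff_pow_le_of_coeff_le
    (coeff_sub_constantCoeff_nonneg (hα.coeff_genSeries_nonneg ht p)) (by simp) hi
    (ε := B * δ ^ p) (by positivity) fun m hm hmj => ?_).trans ?_
  · rw [coeff_sub_C_of_pos _ _ (by omega)]
    exact h m hm hmj p
  · rw [mul_pow, mul_assoc]
    gcongr _ * (_ * ?_)
    rw [← pow_mul, ← pow_mul, mul_comm]
    exact pow_le_pow_of_le_one hδ0 hδ1 (Nat.mul_le_mul_right p hi)

/-- The nonconstant coefficients decay at each rate larger than `f'(κ)`. -/
theorem exists_coeff_genSeries_le {κ t : ℝ} (hκ0 : 0 ≤ κ) (hκ1 : κ < 1)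
    (hκ : binomSum α 0 κ = κ) (ht : 0 ≤ t) (ht1 : t ≤ 1) {δ : ℝ} (hδ : binomSum α 1 κ < δ)
    (hδ1 : δ < 1) (n : ℕ) :
    ∃ B, 0 ≤ B ∧ ∀ j, 1 ≤ j → j < n → ∀ p, coeff j (genSeries α t p) ≤ B * δ ^ p := by
  have hδ0 : 0 < δ := (hα.binomSum_nonneg 1 hκ0).trans_lt hδ
  have ha := hα.tendsto_constantCoeff_genSeries hκ0 hκ1 hκ ht ht1
  have hann := hα.constantCoeff_genSeries_nonneg ht
  induction n with
  | zero => exact ⟨0, le_rfl, fun j _ hj => absurd hj (Nat.not_lt_zero j)⟩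
  | succ n ih =>
    obtain ⟨B, hB0, hB⟩ := ih
    rcases Nat.eq_zero_or_pos n with rfl | hn
    · exact ⟨0, le_rfl, fun j h1 hj => by omega⟩
    -- Eventually the linear coefficient is below `δ' < δ`, and after division by `δ^p` the
    -- recursion becomes an affine contraction with ratio `δ'/δ`.
    obtain ⟨δ', hδ', hδδ'⟩ := exists_between hδ
    have hδ'0 : 0 ≤ δ' := (hα.binomSum_nonneg 1 hκ0).trans hδ'.le
    set K := ∑ i ∈ Finset.Ico 2 (n + 1), (binomSum α i κ + 1) *
      (((Finset.range i).finsuppAntidiag n).card * B ^ i)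
    have hK0 : 0 ≤ K := Finset.sum_nonneg fun i _ =>
      mul_nonneg (add_nonneg (hα.binomSum_nonneg i hκ0) zero_le_one) (by positivity)
    have hev1 : ∀ᶠ p in atTop, binomSum α 1 (constantCoeff (genSeries α t (p + 1))) < δ' :=
      (tendsto_add_atTop_iff_nat 1).2 (hα.tendsto_binomSum 1 hann ha hκ1) |>.eventually_lt_const hδ'
    have hev2 : ∀ᶠ p in atTop, ∀ i ∈ Finset.Ico 2 (n + 1),
        binomSum α i (constantCoeff (genSeries α t (p + 1))) < binomSum α i κ + 1 := by
      rw [Filter.eventually_all_finset]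
      exact fun i _ => (tendsto_add_atTop_iff_nat 1).2 (hα.tendsto_binomSum i hann ha hκ1)
        |>.eventually_lt_const (lt_add_one _)
    have hu : ∀ᶠ p in atTop, coeff n (genSeries α t (p + 1 + 1)) / δ ^ (p + 1) ≤
        (δ' / δ) * (coeff n (genSeries α t (p + 1)) / δ ^ p) + K := by
      filter_upwards [hev1, hev2] with p hp1 hp2
      have hmain : coeff n (genSeries α t (p + 1 + 1)) ≤
          δ' * coeff n (genSeries α t (p + 1)) + K * δ ^ (p + 1) := by
        rw [hα.coeff_genSeries_succ_succ ht ht1 hn, Finset.sum_mul]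
        refine add_le_add (mul_le_mul_of_nonneg_right hp1.le
          (hα.coeff_genSeries_nonneg ht _ _)) (Finset.sum_le_sum fun i hi => ?_)
        have hi2 : 2 ≤ i := (Finset.mem_Ico.1 hi).1
        have h1 := hα.coeff_sub_pow_le ht hδ0.le hδ1.le hB0 hB hi2 (p + 1)
        have h2 : (δ ^ 2) ^ (p + 1) ≤ δ ^ (p + 1) := by
          rw [← pow_mul]
          exact pow_le_pow_of_le_one hδ0.le hδ1.le (by omega)
        rw [mul_assoc]
        refine mul_le_mul (hp2 i hi).le (h1.trans (mul_le_mul_of_nonneg_left h2 (by positivity)))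
          (coeff_pow_nonneg (coeff_sub_constantCoeff_nonneg (hα.coeff_genSeries_nonneg ht _)) _ _)
          (add_nonneg (hα.binomSum_nonneg i hκ0) zero_le_one)
      rw [div_le_iff₀ (by positivity)]
      refine hmain.trans (le_of_eq ?_)
      field_simp
      ring
    obtain ⟨B', hB'⟩ := exists_forall_le_of_le_mul_add
      (u := fun p => coeff n (genSeries α t (p + 1)) / δ ^ p) (div_nonneg hδ'0 hδ0.le)
      ((div_lt_one hδ0).2 hδδ') hu
    -- `B` serves the lower degrees, `B' / δ` undoes the shift of `p` by one, and the last entry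
    -- serves `p = 0`.
    set B'' := max B (max (B' / δ) (coeff n (genSeries α t 0)))
    refine ⟨B'', hB0.trans (le_max_left _ _), fun j h1 hj p => ?_⟩
    rcases Nat.lt_succ_iff_lt_or_eq.1 hj with hj | rfl
    · exact (hB j h1 hj p).trans
        (mul_le_mul_of_nonneg_right (le_max_left _ _) (by positivity))
    · rcases p with _ | p
      · rw [pow_zero, mul_one]
        exact (le_max_right _ _).trans (le_max_right _ _)
      · have h3 := hB' p
        rw [div_le_iff₀ (by positivity)] at h3
        calc coeff j (genSeries α t (p + 1)) ≤ B' * δ ^ p := h3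
          _ = B' / δ * δ ^ (p + 1) := by
            field_simp
            ring
          _ ≤ B'' * δ ^ (p + 1) := mul_le_mul_of_nonneg_right
            ((le_max_left _ _).trans (le_max_right _ _)) (by positivity)

theorem tendsto_coeff_genSeries_zero {κ t : ℝ} (hκ0 : 0 ≤ κ) (hκ1 : κ < 1)
    (hκ : binomSum α 0 κ = κ) (ht : 0 ≤ t) (ht1 : t ≤ 1) {j : ℕ} (hj : 1 ≤ j) :
    Tendsto (fun p => coeff j (genSeries α t p)) atTop (𝓝 0) := by
  obtain ⟨δ, hδ, hδ1⟩ := exists_between (hα.binomSum_one_lt_one hκ0 hκ1 hκ)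
  have hδ0 : 0 < δ := (hα.binomSum_nonneg 1 hκ0).trans_lt hδ
  obtain ⟨B, -, hB⟩ := hα.exists_coeff_genSeries_le hκ0 hκ1 hκ ht ht1 hδ hδ1 (j + 1)
  refine squeeze_zero (fun p => hα.coeff_genSeries_nonneg ht p j) (hB j hj j.lt_succ_self) ?_
  simpa using (tendsto_pow_atTop_nhds_zero_of_lt_one hδ0.le hδ1).const_mul B

/-- A vertex with at least two children multiplies at least two copies of the series, so the range
of degrees known to be positive grows by one at each iteration. -/
theorem coeff_genSeries_pos {t : ℝ} (ht : 0 < t) (ht1 : t ≤ 1) {ℓ : ℕ}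
    (hℓ : Summable fun k : ℕ => (k : ℝ) ^ ℓ * α k) {k : ℕ} (hk : 2 ≤ k) (hαk : 0 < α k)
    (p : ℕ) : ∀ j ≤ ℓ, j ≤ p + 1 → 0 < coeff j (genSeries α t p) := by
  have hnn := hα.coeff_genSeries_nonneg ht.le
  induction p with
  | zero =>
    intro j _ hj
    rw [coeff_genSeries_zero]
    exact mul_pos ht (by exact_mod_cast Nat.choose_pos (by omega))
  | succ p ih =>
    intro j hjℓ hj
    rw [genSeries_succ, coeff_compSeries]
    have hs := hα.summable_coeff_genSeries_pow ht.le ht1 hℓ hjℓ p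
    refine lt_of_lt_of_le ?_ (hs.le_tsum k fun i _ =>
      mul_nonneg (hα.nonneg i) (coeff_pow_nonneg (hnn p) i j))
    refine mul_pos hαk ?_
    have h0 := ih 0 (Nat.zero_le _) (Nat.zero_le _)
    have hmul (P Q : PowerSeries ℝ) (hP : ∀ j, 0 ≤ coeff j P) (hQ : ∀ j, 0 ≤ coeff j Q)
        (a b : ℕ) (ha : 0 < coeff a P) (hb : 0 < coeff b Q) : 0 < coeff (a + b) (P * Q) := by
      rw [coeff_mul]
      refine lt_of_lt_of_le (mul_pos ha hb) (Finset.single_le_sum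
        (f := fun x : ℕ × ℕ => coeff x.1 P * coeff x.2 Q)
        (fun x _ => mul_nonneg (hP _) (hQ _)) (a := (a, b)) (by simp))
    have hpow0 (m : ℕ) : 0 < coeff 0 (genSeries α t p ^ m) := by
      rw [coeff_zero_eq_constantCoeff_apply] at h0 ⊢
      rw [map_pow]
      positivity
    obtain ⟨m, rfl⟩ := Nat.exists_eq_add_of_le hk
    rw [pow_add, pow_two]
    have hsq : ∀ j, 0 ≤ coeff j (genSeries α t p * genSeries α t p) := fun j => by
      rw [← pow_two]; exact coeff_pow_nonneg (hnn p) 2 j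
    refine hmul _ _ hsq (coeff_pow_nonneg (hnn p) m) j 0 ?_ (hpow0 m)
    by_cases hjp : j ≤ p + 1
    · exact hmul _ _ (hnn p) (hnn p) j 0 (ih j hjℓ hjp) h0
    · obtain rfl : j = (p + 1) + 1 := by omega
      exact hmul _ _ (hnn p) (hnn p) (p + 1) 1 (ih _ (by omega) le_rfl)
        (ih 1 (by omega) (by omega))

end IsDefective

/-! ### Ratios of coefficients, and bounds uniform in the exponent. -/

namespace IsDefective

open PowerSeries

variable {α : ℕ → ℝ} (hα : IsDefective α)
include hα

/-- Dropping the nonnegative nonlinear terms leaves a multiplication by `f'` at the constant term,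
which eventually exceeds `β`. -/
theorem exists_le_coeff_genSeries {κ t : ℝ} (hκ0 : 0 ≤ κ) (hκ1 : κ < 1)
    (hκ : binomSum α 0 κ = κ) (ht : 0 ≤ t) (ht1 : t ≤ 1) {ℓ : ℕ} (hℓ : 1 ≤ ℓ)
    (hpos : ∀ᶠ p in atTop, 0 < coeff ℓ (genSeries α t p)) {β : ℝ} (hβ0 : 0 < β)
    (hβ : β < binomSum α 1 κ) :
    ∃ c, 0 < c ∧ ∀ᶠ p in atTop, c * β ^ p ≤ coeff ℓ (genSeries α t p) := by
  have ha := hα.tendsto_constantCoeff_genSeries hκ0 hκ1 hκ ht ht1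
  have hann := hα.constantCoeff_genSeries_nonneg ht
  have hev : ∀ᶠ p in atTop, β < binomSum α 1 (constantCoeff (genSeries α t p)) :=
    (hα.tendsto_binomSum 1 hann ha hκ1).eventually_const_lt hβ
  obtain ⟨p₀, hp₀⟩ := eventually_atTop.1 (hev.and (hpos.and (eventually_ge_atTop 1)))
  refine ⟨coeff ℓ (genSeries α t p₀) / β ^ p₀, div_pos (hp₀ p₀ le_rfl).2.1 (by positivity),
    eventually_atTop.2 ⟨p₀, fun p hp => ?_⟩⟩
  induction p, hp using Nat.le_induction with
  | base => rw [div_mul_cancel₀ _ (by positivity)]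
  | succ p hp ih =>
    obtain ⟨m, rfl⟩ := Nat.exists_eq_add_of_le' (hp₀ p hp).2.2
    rw [show m + 1 + 1 = m + 2 from rfl, hα.coeff_genSeries_succ_succ ht ht1 hℓ m]
    have h1 : 0 ≤ ∑ i ∈ Finset.Ico 2 (ℓ + 1),
        binomSum α i (constantCoeff (genSeries α t (m + 1))) *
          coeff ℓ ((genSeries α t (m + 1) - C (constantCoeff (genSeries α t (m + 1)))) ^ i) :=
      Finset.sum_nonneg fun i _ => mul_nonneg (hα.binomSum_nonneg i (hann _))
        (coeff_pow_nonneg (coeff_sub_constantCoeff_nonneg (hα.coeff_genSeries_nonneg ht _)) _ _)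
    have h2 : β * coeff ℓ (genSeries α t (m + 1)) ≤
        binomSum α 1 (constantCoeff (genSeries α t (m + 1))) * coeff ℓ (genSeries α t (m + 1)) :=
      mul_le_mul_of_nonneg_right (hp₀ _ hp).1.le (hα.coeff_genSeries_nonneg ht _ _)
    have h3 := mul_le_mul_of_nonneg_left ih hβ0.le
    rw [pow_succ β (m + 1)]
    linarith

theorem tendsto_coeff_sub_pow_div {κ t : ℝ} (hκ0 : 0 ≤ κ) (hκ1 : κ < 1)
    (hκ : binomSum α 0 κ = κ) (hγ : 0 < binomSum α 1 κ) (ht : 0 ≤ t) (ht1 : t ≤ 1) {ℓ : ℕ}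
    (hℓ : 1 ≤ ℓ) (hpos : ∀ᶠ p in atTop, 0 < coeff ℓ (genSeries α t p)) {i : ℕ} (hi : 2 ≤ i) :
    Tendsto (fun p => coeff ℓ ((genSeries α t p - C (constantCoeff (genSeries α t p))) ^ i) /
      coeff ℓ (genSeries α t p)) atTop (𝓝 0) := by
  set γ := binomSum α 1 κ with hγdef
  have hγ1 : γ < 1 := hα.binomSum_one_lt_one hκ0 hκ1 hκ
  -- As `0 < γ < 1`, one can take `γ < δ < √γ`. Lower coefficients are `O(δ^p)`, hence nonlinear
  -- terms are `O(δ^{2p})`, while the coefficient of degree `ℓ` is at least of order `β^p` with `δ²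
  -- < β < γ`.
  obtain ⟨δ, hγδ, hδ⟩ := exists_between (show γ < Real.sqrt γ from
    (Real.lt_sqrt hγ.le).2 (by nlinarith))
  have hδ0 : 0 < δ := hγ.trans hγδ
  have hδγ : δ ^ 2 < γ := (Real.lt_sqrt hδ0.le).1 hδ
  have hδ1 : δ < 1 := by nlinarith
  obtain ⟨β, hδβ, hβ⟩ := exists_between hδγ
  have hβ0 : 0 < β := (by positivity : 0 < δ ^ 2).trans hδβ
  obtain ⟨B, hB0, hB⟩ := hα.exists_coeff_genSeries_le hκ0 hκ1 hκ ht ht1 hγδ hδ1 ℓ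
  obtain ⟨c, hc, hlow⟩ := hα.exists_le_coeff_genSeries hκ0 hκ1 hκ ht ht1 hℓ hpos hβ0 hβ
  set K := ((Finset.range i).finsuppAntidiag ℓ).card * B ^ i
  have hlim : Tendsto (fun p : ℕ => K / c * (δ ^ 2 / β) ^ p) atTop (𝓝 0) := by
    simpa using (tendsto_pow_atTop_nhds_zero_of_lt_one (by positivity)
      ((div_lt_one hβ0).2 hδβ)).const_mul (K / c)
  refine squeeze_zero' (Eventually.of_forall fun p => div_nonneg
    (coeff_pow_nonneg (coeff_sub_constantCoeff_nonneg (hα.coeff_genSeries_nonneg ht _)) _ _)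
    (hα.coeff_genSeries_nonneg ht _ _)) ?_ hlim
  filter_upwards [hlow] with p hp
  calc _ ≤ (K * (δ ^ 2) ^ p) / (c * β ^ p) :=
        div_le_div₀ (by positivity) (hα.coeff_sub_pow_le ht hδ0.le hδ1.le hB0 hB hi p)
          (by positivity) hp
    _ = _ := by rw [div_pow]; field_simp

theorem tendsto_coeff_genSeries_succ_div {κ t : ℝ} (hκ0 : 0 ≤ κ) (hκ1 : κ < 1)
    (hκ : binomSum α 0 κ = κ) (hγ : 0 < binomSum α 1 κ) (ht : 0 ≤ t) (ht1 : t ≤ 1) {ℓ : ℕ}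
    (hℓ : 1 ≤ ℓ) (hpos : ∀ᶠ p in atTop, 0 < coeff ℓ (genSeries α t p)) :
    Tendsto (fun p => coeff ℓ (genSeries α t (p + 1)) / coeff ℓ (genSeries α t p)) atTop
      (𝓝 (binomSum α 1 κ)) := by
  have ha := hα.tendsto_constantCoeff_genSeries hκ0 hκ1 hκ ht ht1
  have hann := hα.constantCoeff_genSeries_nonneg ht
  have h1 : Tendsto (fun p => binomSum α 1 (constantCoeff (genSeries α t p)) +
      ∑ i ∈ Finset.Ico 2 (ℓ + 1), binomSum α i (constantCoeff (genSeries α t p)) *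
        (coeff ℓ ((genSeries α t p - C (constantCoeff (genSeries α t p))) ^ i) /
          coeff ℓ (genSeries α t p))) atTop
      (𝓝 (binomSum α 1 κ + ∑ i ∈ Finset.Ico 2 (ℓ + 1), binomSum α i κ * 0)) :=
    (hα.tendsto_binomSum 1 hann ha hκ1).add (tendsto_finsetSum _ fun i hi =>
      (hα.tendsto_binomSum i hann ha hκ1).mul
        (hα.tendsto_coeff_sub_pow_div hκ0 hκ1 hκ hγ ht ht1 hℓ hpos (Finset.mem_Ico.1 hi).1))
  simp only [mul_zero, Finset.sum_const_zero, add_zero] at h1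
  refine h1.congr' ?_
  filter_upwards [hpos, eventually_ge_atTop 1] with p hp hp1
  obtain ⟨m, rfl⟩ := Nat.exists_eq_add_of_le' hp1
  rw [show m + 1 + 1 = m + 2 from rfl, hα.coeff_genSeries_succ_succ ht ht1 hℓ m, add_div,
    mul_div_cancel_right₀ _ hp.ne', Finset.sum_div]
  congr 1
  exact Finset.sum_congr rfl fun i _ => (mul_div_assoc _ _ _).symm

theorem tendsto_coeff_genSeries_add_div {κ t : ℝ} (hκ0 : 0 ≤ κ) (hκ1 : κ < 1)
    (hκ : binomSum α 0 κ = κ) (hγ : 0 < binomSum α 1 κ) (ht : 0 ≤ t) (ht1 : t ≤ 1) {ℓ : ℕ}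
    (hℓ : 1 ≤ ℓ) (hpos : ∀ᶠ p in atTop, 0 < coeff ℓ (genSeries α t p)) (n : ℕ) :
    Tendsto (fun p => coeff ℓ (genSeries α t (n + p)) / coeff ℓ (genSeries α t p)) atTop
      (𝓝 (binomSum α 1 κ ^ n)) := by
  induction n with
  | zero =>
    rw [pow_zero]
    refine tendsto_const_nhds.congr' ?_
    filter_upwards [hpos] with p hp
    rw [zero_add, div_self hp.ne']
  | succ n ih =>
    have h := (hα.tendsto_coeff_genSeries_succ_div hκ0 hκ1 hκ hγ ht ht1 hℓ hpos).comp
      (tendsto_add_atTop_nat n)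
    rw [pow_succ']
    refine (h.mul ih).congr' ?_
    filter_upwards [(tendsto_add_atTop_nat n).eventually hpos] with p hp
    rw [Function.comp_apply, show n + 1 + p = p + n + 1 by ring, add_comm n p,
      div_mul_div_cancel₀ hp.ne']

omit hα in
theorem coeff_pow_eq_add (P : PowerSeries ℝ) {ℓ : ℕ} (hℓ : 1 ≤ ℓ) (z : ℕ) :
    coeff ℓ (P ^ z) = z * constantCoeff P ^ (z - 1) * coeff ℓ P +
      ∑ i ∈ Finset.Ico 2 (ℓ + 1), (z.choose i : ℝ) * constantCoeff P ^ (z - i) *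
        coeff ℓ ((P - C (constantCoeff P)) ^ i) := by
  rw [coeff_pow_eq_sum_sub, Finset.range_eq_Ico, Finset.sum_eq_sum_Ico_succ_bot (by omega),
    Finset.sum_eq_sum_Ico_succ_bot (by omega)]
  have h0 : coeff ℓ (1 : PowerSeries ℝ) = 0 := by rw [coeff_one, if_neg (by omega)]
  rw [pow_zero, h0, mul_zero, zero_add, zero_add, pow_one, coeff_sub_C_of_pos _ _ (by omega),
    Nat.choose_one_right]

theorem tendsto_coeff_genSeries_pow_div {κ t : ℝ} (hκ0 : 0 ≤ κ) (hκ1 : κ < 1)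
    (hκ : binomSum α 0 κ = κ) (hγ : 0 < binomSum α 1 κ) (ht : 0 ≤ t) (ht1 : t ≤ 1) {ℓ : ℕ}
    (hℓ : 1 ≤ ℓ) (hpos : ∀ᶠ p in atTop, 0 < coeff ℓ (genSeries α t p)) (z : ℕ) :
    Tendsto (fun p => coeff ℓ (genSeries α t p ^ z) / coeff ℓ (genSeries α t p)) atTop
      (𝓝 (z * κ ^ (z - 1))) := by
  have ha := hα.tendsto_constantCoeff_genSeries hκ0 hκ1 hκ ht ht1
  have h1 : Tendsto (fun p => z * constantCoeff (genSeries α t p) ^ (z - 1) +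
      ∑ i ∈ Finset.Ico 2 (ℓ + 1),
        (z.choose i : ℝ) * constantCoeff (genSeries α t p) ^ (z - i) *
        (coeff ℓ ((genSeries α t p - C (constantCoeff (genSeries α t p))) ^ i) /
          coeff ℓ (genSeries α t p))) atTop
      (𝓝 (z * κ ^ (z - 1) + ∑ i ∈ Finset.Ico 2 (ℓ + 1), (z.choose i : ℝ) * κ ^ (z - i) * 0)) :=
    ((ha.pow _).const_mul _).add (tendsto_finsetSum _ fun i hi => ((ha.pow _).const_mul _).mul
        (hα.tendsto_coeff_sub_pow_div hκ0 hκ1 hκ hγ ht ht1 hℓ hpos (Finset.mem_Ico.1 hi).1))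
  simp only [mul_zero, Finset.sum_const_zero, add_zero] at h1
  refine h1.congr' ?_
  filter_upwards [hpos] with p hp
  rw [coeff_pow_eq_add _ hℓ, add_div, mul_div_cancel_right₀ _ hp.ne', Finset.sum_div]
  congr 1
  exact Finset.sum_congr rfl fun i _ => (mul_div_assoc _ _ _).symm

/-- The exponent `z` enters only through `C(z, i) a^{z-i}`, with `a` the constant term. Eventually
`a ≤ b < 1`, and these are bounded uniformly in `z`. -/
theorem exists_coeff_genSeries_pow_div_le {κ t : ℝ} (hκ0 : 0 ≤ κ) (hκ1 : κ < 1)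
    (hκ : binomSum α 0 κ = κ) (hγ : 0 < binomSum α 1 κ) (ht : 0 ≤ t) (ht1 : t ≤ 1) {ℓ : ℕ}
    (hℓ : 1 ≤ ℓ) (hpos : ∀ᶠ p in atTop, 0 < coeff ℓ (genSeries α t p)) :
    ∃ K, ∀ᶠ p in atTop, ∀ z : ℕ,
      coeff ℓ (genSeries α t p ^ z) / coeff ℓ (genSeries α t p) ≤ K := by
  have ha := hα.tendsto_constantCoeff_genSeries hκ0 hκ1 hκ ht ht1
  have hann := hα.constantCoeff_genSeries_nonneg ht
  obtain ⟨b, hκb, hb⟩ := exists_between hκ1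
  choose K hK0 hK using fun i => exists_choose_mul_pow_le i (hκ0.trans hκb.le) hb
  have hev : ∀ᶠ p in atTop, ∀ i ∈ Finset.Ico 2 (ℓ + 1),
      coeff ℓ ((genSeries α t p - C (constantCoeff (genSeries α t p))) ^ i) /
        coeff ℓ (genSeries α t p) < 1 := by
    rw [Filter.eventually_all_finset]
    exact fun i hi => (hα.tendsto_coeff_sub_pow_div hκ0 hκ1 hκ hγ ht ht1 hℓ hpos
      (Finset.mem_Ico.1 hi).1).eventually_lt_const one_pos
  refine ⟨K 1 + ∑ i ∈ Finset.Ico 2 (ℓ + 1), K i * 1, ?_⟩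
  filter_upwards [hpos, hev, ha.eventually_lt_const hκb] with p hp hp2 hpb z
  rw [coeff_pow_eq_add _ hℓ, add_div, mul_div_cancel_right₀ _ hp.ne', Finset.sum_div]
  refine add_le_add ?_ (Finset.sum_le_sum fun i hi => ?_)
  · simpa using hK 1 z _ (hann p) hpb.le
  · rw [mul_div_assoc]
    exact mul_le_mul (hK i z _ (hann p) hpb.le) (hp2 i hi).le (div_nonneg
      (coeff_pow_nonneg (coeff_sub_constantCoeff_nonneg (hα.coeff_genSeries_nonneg ht _)) _ _)
      hp.le) (hK0 i)

/-- If the fixed point is `0`, the coefficients of the positive powers vanish in the limit. -/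
theorem tendsto_coeff_genSeries_pow_zero (h0 : binomSum α 0 0 = 0) {t : ℝ} (ht : 0 ≤ t)
    (ht1 : t ≤ 1) (z j : ℕ) :
    Tendsto (fun p => coeff j (genSeries α t p ^ (z + 1))) atTop (𝓝 0) := by
  induction z generalizing j with
  | zero =>
    simp only [zero_add, pow_one]
    rcases Nat.eq_zero_or_pos j with rfl | hj
    · simpa using hα.tendsto_constantCoeff_genSeries le_rfl zero_lt_one h0 ht ht1
    · exact hα.tendsto_coeff_genSeries_zero le_rfl zero_lt_one h0 ht ht1 hj
  | succ z ih =>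
    have h1 (j : ℕ) : Tendsto (fun p => coeff j (genSeries α t p)) atTop (𝓝 0) := by
      rcases Nat.eq_zero_or_pos j with rfl | hj
      · simpa using hα.tendsto_constantCoeff_genSeries le_rfl zero_lt_one h0 ht ht1
      · exact hα.tendsto_coeff_genSeries_zero le_rfl zero_lt_one h0 ht ht1 hj
    simp_rw [pow_succ _ (z + 1), coeff_mul]
    have := tendsto_finsetSum (Finset.HasAntidiagonal.antidiagonal j) fun x _ =>
      (ih x.1).mul (h1 x.2)
    simpa using this

theorem exists_coeff_genSeries_pow_le {κ t : ℝ} (hκ0 : 0 ≤ κ) (hκ1 : κ < 1)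
    (hκ : binomSum α 0 κ = κ) (ht : 0 ≤ t) (ht1 : t ≤ 1) (j : ℕ) :
    ∃ K, 0 ≤ K ∧ ∀ᶠ p in atTop, ∀ z : ℕ, coeff j (genSeries α t p ^ z) ≤ K := by
  have ha := hα.tendsto_constantCoeff_genSeries hκ0 hκ1 hκ ht ht1
  have hann := hα.constantCoeff_genSeries_nonneg ht
  obtain ⟨b, hκb, hb⟩ := exists_between hκ1
  choose K hK0 hK using fun i => exists_choose_mul_pow_le i (hκ0.trans hκb.le) hb
  obtain ⟨δ, hδ, hδ1⟩ := exists_between (hα.binomSum_one_lt_one hκ0 hκ1 hκ)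
  have hδ0 : 0 < δ := (hα.binomSum_nonneg 1 hκ0).trans_lt hδ
  obtain ⟨B, hB0, hB⟩ := hα.exists_coeff_genSeries_le hκ0 hκ1 hκ ht ht1 hδ hδ1 (j + 1)
  -- The three summands of the bound take care of `i = 0`, `i = 1` and `i ≥ 2`.
  have hQ (i p : ℕ) :
      coeff j ((genSeries α t p - C (constantCoeff (genSeries α t p))) ^ i) ≤
        1 + B + ((Finset.range i).finsuppAntidiag j).card * B ^ i := by
    have hx : 0 ≤ (((Finset.range i).finsuppAntidiag j).card : ℝ) * B ^ i := by positivity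
    rcases i with _ | _ | i
    · have : coeff j (1 : PowerSeries ℝ) ≤ 1 := by
        rw [coeff_one]
        split_ifs <;> norm_num
      rw [pow_zero]
      linarith
    · rcases Nat.eq_zero_or_pos j with rfl | hj
      · simp only [zero_add, pow_one, map_sub, coeff_zero_eq_constantCoeff_apply,
          constantCoeff_C, sub_self] at hx ⊢
        linarith
      · have h1 := hB j hj j.lt_succ_self p
        have h2 : B * δ ^ p ≤ B := mul_le_of_le_one_right hB0 (pow_le_one₀ hδ0.le hδ1.le)
        rw [zero_add, pow_one, coeff_sub_C_of_pos _ _ (by omega)]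
        rw [zero_add] at hx
        linarith
    · have h1 := hα.coeff_sub_pow_le ht hδ0.le hδ1.le hB0
        (fun m h1 h2 => hB m h1 (h2.trans j.lt_succ_self)) (i := i + 1 + 1) (by omega) p
      have h2 := mul_le_of_le_one_right hx
        (pow_le_one₀ (by positivity) (pow_le_one₀ hδ0.le hδ1.le) : (δ ^ 2) ^ p ≤ 1)
      linarith
  refine ⟨∑ i ∈ Finset.range (j + 1), K i *
    (1 + B + ((Finset.range i).finsuppAntidiag j).card * B ^ i),
    Finset.sum_nonneg fun i _ => mul_nonneg (hK0 i) (by positivity), ?_⟩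
  filter_upwards [ha.eventually_lt_const hκb] with p hpb z
  rw [coeff_pow_eq_sum_sub]
  exact Finset.sum_le_sum fun i _ => mul_le_mul (hK i z _ (hann p) hpb.le) (hQ i p)
    (coeff_pow_nonneg (coeff_sub_constantCoeff_nonneg (hα.coeff_genSeries_nonneg ht _)) _ _)
    (hK0 i)

end IsDefective

/-! ### Series with coefficients nondecreasing up to degree `ℓ`. -/

namespace PowerSeries

/-- Single out one factor `P` and index the convolution by the degree taken by the other `N`:
raising the total degree from `i` to `ℓ` increases each coefficient of `P` used and adds nonnegative
terms. -/
theorem coeff_pow_le_of_monotone {P : PowerSeries ℝ} (hP : ∀ j, 0 ≤ coeff j P) {ℓ : ℕ}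
    (hmono : ∀ i j, i ≤ j → j ≤ ℓ → coeff i P ≤ coeff j P) (N : ℕ) {i : ℕ} (hi : i ≤ ℓ) :
    coeff i (P ^ (N + 1)) ≤ coeff ℓ (P ^ (N + 1)) := by
  rw [pow_succ', coeff_mul, coeff_mul, Finset.Nat.sum_antidiagonal_eq_sum_range_succ
    (fun a b => coeff a P * coeff b (P ^ N)), Finset.Nat.sum_antidiagonal_eq_sum_range_succ
    (fun a b => coeff a P * coeff b (P ^ N)), ← Finset.sum_range_reflect,
    ← Finset.sum_range_reflect (n := ℓ.succ)]
  have hnn := coeff_pow_nonneg hP N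
  refine (Finset.sum_le_sum fun a ha => ?_).trans (Finset.sum_le_sum_of_subset_of_nonneg
    (Finset.range_mono (Nat.succ_le_succ hi)) fun a _ _ => mul_nonneg (hP _) (hnn _))
  rw [Finset.mem_range] at ha
  have e1 : i - (i.succ - 1 - a) = a := by omega
  have e2 : ℓ - (ℓ.succ - 1 - a) = a := by omega
  rw [e1, e2]
  exact mul_le_mul_of_nonneg_right (hmono _ _ (by omega) (by omega)) (hnn a)

/-- The extra `z` factors can be split off at the cost of a finite sum, which tends to zero in the
application when `z ≥ 1`. -/
theorem coeff_pow_add_le {P : PowerSeries ℝ} (hP : ∀ j, 0 ≤ coeff j P) {ℓ : ℕ}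
    (hmono : ∀ i j, i ≤ j → j ≤ ℓ → coeff i P ≤ coeff j P) {N : ℕ} (hN : 1 ≤ N) (z : ℕ) :
    coeff ℓ (P ^ (N + z)) ≤
      coeff ℓ (P ^ N) * ∑ j ∈ Finset.range (ℓ + 1), coeff j (P ^ z) := by
  obtain ⟨N, rfl⟩ := Nat.exists_eq_add_of_le' hN
  rw [pow_add, mul_comm (P ^ (N + 1)), coeff_mul, Finset.Nat.sum_antidiagonal_eq_sum_range_succ
    (fun a b => coeff a (P ^ z) * coeff b (P ^ (N + 1))), Finset.mul_sum]
  refine Finset.sum_le_sum fun a _ => ?_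
  rw [mul_comm]
  exact mul_le_mul_of_nonneg_right (coeff_pow_le_of_monotone hP hmono N (by omega))
    (coeff_pow_nonneg hP z a)

end PowerSeries

/-! ### Transfer from `ENNReal` to `ℝ`, and the weights `α_k(s)`. -/

/-- Only degrees up to `ℓ` are compared: they involve no higher coefficient, and higher ones may be
infinite in `ENNReal` when only the moment of order `ℓ` is finite. -/
theorem coeff_pow_eq_ofReal {P : PowerSeries ENNReal} {Q : PowerSeries ℝ}
    (hQ : ∀ j, 0 ≤ PowerSeries.coeff j Q) {ℓ : ℕ}
    (h : ∀ j ≤ ℓ, PowerSeries.coeff j P = ENNReal.ofReal (PowerSeries.coeff j Q)) (k : ℕ) :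
    ∀ j ≤ ℓ, PowerSeries.coeff j (P ^ k) = ENNReal.ofReal (PowerSeries.coeff j (Q ^ k)) := by
  intro j hj
  rw [PowerSeries.coeff_pow, PowerSeries.coeff_pow, ENNReal.ofReal_sum_of_nonneg
    fun l _ => Finset.prod_nonneg fun i _ => hQ _]
  refine Finset.sum_congr rfl fun l hl => ?_
  rw [ENNReal.ofReal_prod_of_nonneg fun i _ => hQ _]
  refine Finset.prod_congr rfl fun i hi => h _ ?_
  rw [Finset.mem_finsuppAntidiag] at hl
  exact ((Finset.single_le_sum (f := l) (fun _ _ => Nat.zero_le _) hi).trans_eq hl.1).trans hj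

theorem coeff_genSeries_eq_ofReal {α : ℕ → ℝ} (hα : IsDefective α) {t : ℝ} (ht : 0 ≤ t)
    (ht1 : t ≤ 1) {ℓ : ℕ} (hℓ : Summable fun k : ℕ => (k : ℝ) ^ ℓ * α k) (p : ℕ) :
    ∀ j ≤ ℓ, PowerSeries.coeff j
        (genSeries (fun k => ENNReal.ofReal (α k)) (ENNReal.ofReal t) p) =
      ENNReal.ofReal (PowerSeries.coeff j (genSeries α t p)) := by
  induction p with
  | zero =>
    intro j _
    rw [coeff_genSeries_zero, coeff_genSeries_zero, ENNReal.ofReal_mul ht, ENNReal.ofReal_natCast]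
  | succ p ih =>
    intro j hj
    rw [genSeries_succ, genSeries_succ, coeff_compSeries, coeff_compSeries,
      ENNReal.ofReal_tsum_of_nonneg (fun k => mul_nonneg (hα.nonneg k)
        (PowerSeries.coeff_pow_nonneg (hα.coeff_genSeries_nonneg ht p) k j))
        (hα.summable_coeff_genSeries_pow ht ht1 hℓ hj p)]
    refine tsum_congr fun k => ?_
    rw [ENNReal.ofReal_mul (hα.nonneg k),
      coeff_pow_eq_ofReal (hα.coeff_genSeries_nonneg ht p) ih k j hj]

section Weights

variable (p : PMF ℕ) (q : ℕ → unitInterval) {s : ℝ} (hs : s ∈ Ioo (0 : ℝ) 1)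
include hs

theorem alpha_factor_pos (k : ℕ) : 0 < s * (q k : ℝ) + 1 - q k := by
  nlinarith [hs.1, hs.2, (q k).2.1, (q k).2.2, mul_nonneg hs.1.le (q k).2.1]

theorem alpha_nonneg (k : ℕ) : 0 ≤ alpha p q k s :=
  mul_nonneg ENNReal.toReal_nonneg (alpha_factor_pos q hs k).le

theorem alpha_pos {k : ℕ} (hk : p k ≠ 0) : 0 < alpha p q k s :=
  mul_pos (ENNReal.toReal_pos hk (p.apply_ne_top k)) (alpha_factor_pos q hs k)

theorem alpha_le (k : ℕ) : alpha p q k s ≤ (p k).toReal := by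
  refine mul_le_of_le_one_right ENNReal.toReal_nonneg ?_
  nlinarith [hs.1, hs.2, (q k).2.1, (q k).2.2]

omit hs in
theorem summable_pmf_toReal : Summable fun k => (p k).toReal :=
  ENNReal.summable_toReal p.tsum_coe_ne_top

theorem isDefective_alpha (hq : ∃ k, 0 < (p k).toReal * (q k : ℝ)) :
    IsDefective fun k => alpha p q k s where
  nonneg := alpha_nonneg p q hs
  summable := (summable_pmf_toReal p).of_nonneg_of_le (alpha_nonneg p q hs) (alpha_le p q hs)
  tsum_lt_one := by
    obtain ⟨k, hk⟩ := hq
    have h1 : ∑' k, (p k).toReal = 1 := by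
      rw [← ENNReal.tsum_toReal_eq fun k => p.apply_ne_top k, p.tsum_coe, ENNReal.toReal_one]
    rw [← h1]
    refine Summable.tsum_lt_tsum (i := k) (alpha_le p q hs) ?_
      ((summable_pmf_toReal p).of_nonneg_of_le (alpha_nonneg p q hs) (alpha_le p q hs))
      (summable_pmf_toReal p)
    unfold alpha
    nlinarith [hs.2]

theorem ealpha_ofReal :
    ealpha p q (ENNReal.ofReal s) = fun k => ENNReal.ofReal (alpha p q k s) := by
  funext k
  have h0 := (q k).2.1
  have h1 : (0 : ℝ) ≤ 1 - q k := sub_nonneg.2 (q k).2.2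
  rw [ealpha, alpha, ENNReal.ofReal_mul ENNReal.toReal_nonneg,
    ENNReal.ofReal_toReal (p.apply_ne_top k), ← ENNReal.ofReal_mul h0,
    ← ENNReal.ofReal_add h1 (mul_nonneg h0 hs.1.le)]
  congr 2
  ring

theorem summable_pow_mul_alpha {ℓ : ℕ}
    (hmoment : Summable fun k : ℕ => (k : ℝ) ^ ℓ * (p k).toReal) :
    Summable fun k : ℕ => (k : ℝ) ^ ℓ * alpha p q k s :=
  hmoment.of_nonneg_of_le (fun k => mul_nonneg (by positivity) (alpha_nonneg p q hs k))
    fun k => mul_le_mul_of_nonneg_left (alpha_le p q hs k) (by positivity)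

end Weights

/-! ### The penalty as a coefficient, and reduction to deterministic ratios. -/

theorem hilbertPoly_natCast (ℓ z : ℕ) : hilbertPoly ℓ (z : ℝ) = (z.choose ℓ : ℝ) := by
  rw [hilbertPoly, div_eq_iff (by positivity)]
  have h : (z.choose ℓ : ℝ) * (ℓ.factorial : ℝ) = (z.descFactorial ℓ : ℝ) := by
    rw [Nat.descFactorial_eq_factorial_mul_choose]
    push_cast
    ring
  rw [h, Nat.descFactorial_eq_prod_range, Nat.cast_prod]
  by_cases hz : ℓ ≤ z
  · refine Finset.prod_congr rfl fun i hi => ?_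
    rw [Finset.mem_range] at hi
    rw [Nat.cast_sub (by omega)]
  · push Not at hz
    rw [Finset.prod_eq_zero (Finset.mem_range.2 hz) (sub_self _),
      Finset.prod_eq_zero (Finset.mem_range.2 hz) (by simp)]

theorem penalty_nonneg (ℓ : ℕ) {s t : ℝ} (hs : 0 ≤ s) (ht : 0 ≤ t) (m : ℕ) (τ : MarkedTree) :
    0 ≤ penalty ℓ s t m τ := by
  rw [penalty, hilbertPoly_natCast]
  positivity

theorem ofReal_penalty (ℓ : ℕ) {s t : ℝ} (hs : 0 ≤ s) (ht : 0 ≤ t) (m : ℕ) (τ : MarkedTree) :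
    ENNReal.ofReal (penalty ℓ s t m τ) = ENNReal.ofReal s ^ τ.M m * PowerSeries.coeff ℓ
      ((PowerSeries.C (ENNReal.ofReal t) * (1 + PowerSeries.X)) ^ τ.Z m) := by
  rw [penalty, hilbertPoly_natCast, coeff_C_mul_one_add_X_pow, ENNReal.ofReal_mul (by positivity),
    ENNReal.ofReal_mul (by positivity), ENNReal.ofReal_pow hs, ENNReal.ofReal_pow ht,
    ENNReal.ofReal_natCast]
  ring

namespace MarkedTree

theorem measurable_comp_M_Z (g : ℕ → ℕ → ℝ) (n : ℕ) :
    Measurable[filtration n] fun τ : MarkedTree => g (τ.M n) (τ.Z n) :=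
  (measurable_of_countable fun x : ℕ × ℕ => g x.1 x.2).comp
    ((measurable_filtration_M n).prodMk (measurable_filtration_Z n))

theorem measurable_comp_M_Z' (g : ℕ → ℕ → ℝ) (n : ℕ) :
    Measurable fun τ : MarkedTree => g (τ.M n) (τ.Z n) :=
  (measurable_comp_M_Z g n).mono (filtration.le n) le_rfl

end MarkedTree

section Penalty

variable (p : PMF ℕ) (q : ℕ → unitInterval) {s : ℝ} (hs : s ∈ Ioo (0 : ℝ) 1)
  (hq : ∃ k, 0 < (p k).toReal * (q k : ℝ)) {ℓ : ℕ}
  (hmoment : Summable fun k : ℕ => (k : ℝ) ^ ℓ * (p k).toReal) {t : ℝ} (ht : 0 ≤ t) (ht1 : t ≤ 1)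
include hs hq hmoment ht ht1

/-- The penalization function is transported `k` generations back by the coefficients of the
iterated generating series. -/
theorem setLIntegral_penalty {j : ℕ} (hj : j ≤ ℓ) (n k : ℕ) {Λ : Set MarkedTree}
    (hΛ : MeasurableSet[MarkedTree.filtration n] Λ) :
    ∫⁻ τ in Λ, ENNReal.ofReal (penalty j s t (n + k) τ) ∂(mgwLaw p q) =
      ∫⁻ τ in Λ, ENNReal.ofReal (s ^ τ.M n *
        PowerSeries.coeff j (genSeries (fun k => alpha p q k s) t k ^ τ.Z n)) ∂(mgwLaw p q) := by
  have hα := isDefective_alpha p q hs hq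
  simp_rw [ofReal_penalty j hs.1.le ht]
  rw [MarkedTree.setLIntegral_add p q _ _ n k j hΛ]
  refine lintegral_congr fun τ => ?_
  have h : (compSeries (ealpha p q (ENNReal.ofReal s)))^[k]
      (PowerSeries.C (ENNReal.ofReal t) * (1 + PowerSeries.X)) =
      genSeries (fun k => ENNReal.ofReal (alpha p q k s)) (ENNReal.ofReal t) k := by
    rw [ealpha_ofReal p q hs, genSeries]
  rw [h, ENNReal.ofReal_mul (pow_nonneg hs.1.le _), ENNReal.ofReal_pow hs.1.le,
    coeff_pow_eq_ofReal (hα.coeff_genSeries_nonneg ht k) (coeff_genSeries_eq_ofReal hα ht ht1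
      (summable_pow_mul_alpha p q hs hmoment) k) _ j hj]

omit hs hq hmoment ht ht1 in
theorem measurable_penalty (ℓ : ℕ) (s t : ℝ) (m : ℕ) : Measurable (penalty ℓ s t m) :=
  MarkedTree.measurable_comp_M_Z' (fun a b => hilbertPoly ℓ b * s ^ a * t ^ b) m

theorem setIntegral_penalty {j : ℕ} (hj : j ≤ ℓ) (n k : ℕ) {Λ : Set MarkedTree}
    (hΛ : MeasurableSet[MarkedTree.filtration n] Λ) :
    ∫ τ in Λ, penalty j s t (n + k) τ ∂(mgwLaw p q) =
      ∫ τ in Λ, s ^ τ.M n *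
        PowerSeries.coeff j (genSeries (fun k => alpha p q k s) t k ^ τ.Z n) ∂(mgwLaw p q) := by
  have hα := isDefective_alpha p q hs hq
  rw [integral_eq_lintegral_of_nonneg_ae
      (Eventually.of_forall fun τ => penalty_nonneg j hs.1.le ht _ τ)
      (measurable_penalty j s t _).aestronglyMeasurable,
    integral_eq_lintegral_of_nonneg_ae (Eventually.of_forall fun τ =>
      mul_nonneg (pow_nonneg hs.1.le _) (PowerSeries.coeff_pow_nonneg
        (hα.coeff_genSeries_nonneg ht k) _ _))
      (MarkedTree.measurable_comp_M_Z' (fun a b => s ^ a * PowerSeries.coeff j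
        (genSeries (fun k => alpha p q k s) t k ^ b)) n).aestronglyMeasurable,
    setLIntegral_penalty p q hs hq hmoment ht ht1 hj n k hΛ]

theorem lintegral_penalty {j : ℕ} (hj : j ≤ ℓ) (k : ℕ) :
    ∫⁻ τ, ENNReal.ofReal (penalty j s t k τ) ∂(mgwLaw p q) =
      ENNReal.ofReal (PowerSeries.coeff j (genSeries (fun k => alpha p q k s) t k)) := by
  have h := setLIntegral_penalty p q hs hq hmoment ht ht1 hj 0 k (Λ := Set.univ)
    (@MeasurableSet.univ _ (MarkedTree.filtration 0))
  simpa [MarkedTree.Z_zero, MarkedTree.M_zero] using h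

theorem integrable_penalty {j : ℕ} (hj : j ≤ ℓ) (k : ℕ) :
    Integrable (penalty j s t k) (mgwLaw p q) := by
  refine ⟨(measurable_penalty j s t k).aestronglyMeasurable, ?_⟩
  rw [hasFiniteIntegral_iff_ofReal (Eventually.of_forall fun τ => penalty_nonneg j hs.1.le ht _ τ),
    lintegral_penalty p q hs hq hmoment ht ht1 hj]
  exact ENNReal.ofReal_lt_top

theorem integral_penalty {j : ℕ} (hj : j ≤ ℓ) (k : ℕ) :
    ∫ τ, penalty j s t k τ ∂(mgwLaw p q) =
      PowerSeries.coeff j (genSeries (fun k => alpha p q k s) t k) := by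
  rw [integral_eq_lintegral_of_nonneg_ae
      (Eventually.of_forall fun τ => penalty_nonneg j hs.1.le ht _ τ)
      (measurable_penalty j s t _).aestronglyMeasurable,
      lintegral_penalty p q hs hq hmoment ht ht1 hj, ENNReal.toReal_ofReal
      ((isDefective_alpha p q hs hq).coeff_genSeries_nonneg ht k j)]

omit hmoment hq ht ht1 in
/-- Dominated convergence for functionals of `(M n, Z n)`. -/
theorem tendsto_setIntegral_comp_Z {g : ℕ → ℕ → ℝ} {b : ℕ → ℝ} {K : ℝ} (n : ℕ)
    (hg0 : ∀ᶠ k in atTop, ∀ z, 0 ≤ g k z)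
    (hgK : ∀ᶠ k in atTop, ∀ z, minOffspring p ^ n ≤ z → g k z ≤ K)
    (hg : ∀ z, minOffspring p ^ n ≤ z → Tendsto (fun k => g k z) atTop (𝓝 (b z)))
    (Λ : Set MarkedTree) :
    Tendsto (fun k => ∫ τ in Λ, s ^ τ.M n * g k (τ.Z n) ∂(mgwLaw p q)) atTop
      (𝓝 (∫ τ in Λ, s ^ τ.M n * b (τ.Z n) ∂(mgwLaw p q))) := by
  have hZ := ae_restrict_of_ae (s := Λ) (MarkedTree.ae_minOffspring_pow_le_Z p q n)
  refine tendsto_integral_filter_of_dominated_convergence (fun _ => K)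
    (Eventually.of_forall fun k => (MarkedTree.measurable_comp_M_Z' (fun a b => s ^ a * g k b)
      n).aestronglyMeasurable) ?_ (integrable_const K) ?_
  · filter_upwards [hg0, hgK] with k h0 hK
    filter_upwards [hZ] with τ hτ
    rw [Real.norm_of_nonneg (mul_nonneg (pow_nonneg hs.1.le _) (h0 _))]
    exact (mul_le_of_le_one_left (h0 _) (pow_le_one₀ hs.1.le hs.2.le)).trans (hK _ hτ)
  · filter_upwards [hZ] with τ hτ
    exact (hg _ hτ).const_mul _

/-- All probability is absorbed here; what remains is the asymptotics of real sequences. -/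
theorem penalizationLimit_of_tendsto
    (hpos : ∀ᶠ k in atTop,
      0 < PowerSeries.coeff ℓ (genSeries (fun k => alpha p q k s) t k)) {b : ℕ → ℕ → ℝ}
    (hb : ∀ n z, minOffspring p ^ n ≤ z → Tendsto (fun k =>
      PowerSeries.coeff ℓ (genSeries (fun k => alpha p q k s) t k ^ z) /
        PowerSeries.coeff ℓ (genSeries (fun k => alpha p q k s) t (n + k))) atTop (𝓝 (b n z)))
    (hK : ∀ n, ∃ K, ∀ᶠ k in atTop, ∀ z, minOffspring p ^ n ≤ z →
      PowerSeries.coeff ℓ (genSeries (fun k => alpha p q k s) t k ^ z) /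
        PowerSeries.coeff ℓ (genSeries (fun k => alpha p q k s) t (n + k)) ≤ K) :
    PenalizationLimit (mgwLaw p q) (penalty ℓ s t) fun n τ => s ^ τ.M n * b n (τ.Z n) := by
  have hα := isDefective_alpha p q hs hq
  set A := genSeries (fun k => alpha p q k s) t with hA
  have hnn (n k z : ℕ) : 0 ≤ PowerSeries.coeff ℓ (A k ^ z) / PowerSeries.coeff ℓ (A (n + k)) :=
    div_nonneg (PowerSeries.coeff_pow_nonneg (hα.coeff_genSeries_nonneg ht k) _ _)
      (hα.coeff_genSeries_nonneg ht _ _)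
  have hint (n : ℕ) : Integrable (fun τ : MarkedTree => s ^ τ.M n * b n (τ.Z n))
      (mgwLaw p q) := by
    obtain ⟨K, hK⟩ := hK n
    refine Integrable.of_bound (MarkedTree.measurable_comp_M_Z' (fun a z => s ^ a * b n z)
      n).aestronglyMeasurable K ?_
    filter_upwards [MarkedTree.ae_minOffspring_pow_le_Z p q n] with τ hτ
    have h0 : 0 ≤ b n (τ.Z n) := ge_of_tendsto' (hb n _ hτ) fun k => hnn n k _
    have h1 : b n (τ.Z n) ≤ K := le_of_tendsto (hb n _ hτ) (hK.mono fun k hk => hk _ hτ)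
    rw [Real.norm_of_nonneg (mul_nonneg (pow_nonneg hs.1.le _) h0)]
    exact (mul_le_of_le_one_left h0 (pow_le_one₀ hs.1.le hs.2.le)).trans h1
  have hlim (n : ℕ) (Λ : Set MarkedTree) (hΛ : MeasurableSet[MarkedTree.filtration n] Λ) :
      Tendsto (fun k : ℕ => (∫ τ in Λ, penalty ℓ s t (n + k) τ ∂(mgwLaw p q)) /
        ∫ τ, penalty ℓ s t (n + k) τ ∂(mgwLaw p q)) atTop
      (𝓝 (∫ τ in Λ, s ^ τ.M n * b n (τ.Z n) ∂(mgwLaw p q))) := by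
    obtain ⟨K, hK⟩ := hK n
    refine (tendsto_setIntegral_comp_Z p q hs n
      (Eventually.of_forall fun k z => hnn n k z) hK (hb n) Λ).congr fun k => ?_
    rw [setIntegral_penalty p q hs hq hmoment ht ht1 le_rfl n k hΛ,
      integral_penalty p q hs hq hmoment ht ht1 le_rfl, ← integral_div]
    simp_rw [mul_div_assoc]
    rfl
  refine ⟨fun m => integrable_penalty p q hs hq hmoment ht ht1 le_rfl m, ?_, hint, ?_, hlim⟩
  · filter_upwards [hpos] with k hk
    rwa [integral_penalty p q hs hq hmoment ht ht1 le_rfl]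
  · refine martingale_of_setIntegral_eq_succ (fun n => ?_) hint fun n Λ hΛ => ?_
    · exact (MarkedTree.measurable_comp_M_Z (fun a z => s ^ a * b n z) n).stronglyMeasurable
    · have h1 := (tendsto_add_atTop_iff_nat 1).2 (hlim n Λ hΛ)
      have h2 := hlim (n + 1) Λ (MarkedTree.filtration.mono n.le_succ _ hΛ)
      refine tendsto_nhds_unique h1 (h2.congr fun k => ?_)
      rw [show n + 1 + k = n + (k + 1) by ring]

end Penalty

/-! ### Lowest coefficients, and auxiliary facts on the offspring law and `f_s`. -/

/-- If `P` starts at degree `N`, then `P^k` starts no earlier than degree `Nk`, so only `k = r`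
contributes in degree `Nr`. -/
theorem coeff_compSeries_of_order {α : ℕ → ENNReal} {r : ℕ} (hα : ∀ k < r, α k = 0) {N : ℕ}
    (hN : 1 ≤ N) {P : PowerSeries ENNReal} (hP : ∀ m < N, PowerSeries.coeff m P = 0) :
    (∀ m < N * r, PowerSeries.coeff m (compSeries α P) = 0) ∧
      PowerSeries.coeff (N * r) (compSeries α P) = α r * PowerSeries.coeff N P ^ r := by
  obtain ⟨R, rfl⟩ := PowerSeries.X_pow_dvd_iff.2 hP
  have hc (k m : ℕ) : PowerSeries.coeff m ((PowerSeries.X ^ N * R) ^ k) =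
      if N * k ≤ m then PowerSeries.coeff (m - N * k) (R ^ k) else 0 := by
    rw [mul_pow, ← pow_mul, PowerSeries.coeff_X_pow_mul']
  constructor
  · intro m hm
    rw [coeff_compSeries, ENNReal.tsum_eq_zero]
    intro k
    rcases lt_or_ge k r with hk | hk
    · rw [hα k hk, zero_mul]
    · have := Nat.mul_le_mul_left N hk
      rw [hc, if_neg (by omega), mul_zero]
  · rw [coeff_compSeries, tsum_eq_single r]
    · rw [hc, if_pos le_rfl, Nat.sub_self, PowerSeries.coeff_zero_eq_constantCoeff_apply, map_pow,
        PowerSeries.coeff_X_pow_mul', if_pos le_rfl, Nat.sub_self,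
        PowerSeries.coeff_zero_eq_constantCoeff_apply]
    · intro k hk
      rcases lt_or_gt_of_ne hk with hk | hk
      · rw [hα k hk, zero_mul]
      · have := Nat.mul_lt_mul_of_pos_left hk hN
        rw [hc, if_neg (by omega), mul_zero]

theorem coeff_iterate_compSeries_X {α : ℕ → ENNReal} {r : ℕ} (hr : 1 ≤ r)
    (hα : ∀ k < r, α k = 0) (n : ℕ) :
    (∀ m < r ^ n, PowerSeries.coeff m ((compSeries α)^[n] PowerSeries.X) = 0) ∧
      PowerSeries.coeff (r ^ n) ((compSeries α)^[n] PowerSeries.X) =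
        α r ^ ∑ i ∈ Finset.range n, r ^ i := by
  induction n with
  | zero =>
    refine ⟨fun m hm => ?_, by simp⟩
    rw [pow_zero, Nat.lt_one_iff] at hm
    simp [hm]
  | succ n ih =>
    rw [Function.iterate_succ_apply']
    have h := coeff_compSeries_of_order hα (Nat.one_le_pow n r hr) ih.1
    rw [pow_succ r n]
    refine ⟨h.1, ?_⟩
    -- The exponent counts the vertices of generations `0, …, n - 1` of the `r`-ary tree, and `1 + r
    -- ∑_{i<n} r^i = ∑_{i≤n} r^i`.
    rw [h.2, ih.2, ← pow_mul, ← pow_succ', Finset.sum_range_succ', Finset.sum_mul]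
    congr 1

theorem apply_minOffspring_ne_zero (p : PMF ℕ) : p (minOffspring p) ≠ 0 := by
  have h : (minOffspring p) ∈ {k | 0 < p k} := by
    obtain ⟨k, hk⟩ := p.support_nonempty
    exact Nat.sInf_mem ⟨k, pos_iff_ne_zero.2 hk⟩
  exact h.ne'

theorem apply_eq_zero_of_lt_minOffspring {p : PMF ℕ} {k : ℕ} (hk : k < minOffspring p) :
    p k = 0 := by
  have := Nat.notMem_of_lt_sInf hk
  simpa using this

theorem exists_two_le_apply_ne_zero {p : PMF ℕ} (hp : p 0 + p 1 < 1) : ∃ k, 2 ≤ k ∧ p k ≠ 0 := by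
  by_contra! h
  have h1 := p.tsum_coe
  rw [tsum_eq_sum (s := Finset.range 2) fun k hk =>
      h k (not_lt.1 fun h' => hk (Finset.mem_range.2 h')),
    Finset.sum_range_succ, Finset.sum_range_one] at h1
  exact hp.ne h1

namespace IsDefective

variable {α : ℕ → ℝ} (hα : IsDefective α)
include hα

theorem hasDerivAt_binomSum_zero {x : ℝ} (hx0 : 0 < x) (hx1 : x < 1) :
    HasDerivAt (binomSum α 0) (binomSum α 1 x) x := by
  obtain ⟨b, hxb, hb⟩ := exists_between hx1
  obtain ⟨K, hK0, hK⟩ := exists_choose_mul_pow_le 1 (hx0.trans hxb).le hb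
  have hf : binomSum α 0 = fun x => ∑' k, α k * x ^ k := funext (binomSum_zero α)
  rw [hf]
  unfold binomSum
  refine hasDerivAt_tsum_of_isPreconnected (u := fun k => α k * K) (t := Ioo 0 b)
    (hα.summable.mul_right K) isOpen_Ioo isPreconnected_Ioo (fun k y _ => ?_) (fun k y hy => ?_)
    (g := fun k y => α k * y ^ k) (g' := fun k y => α k * ((k.choose 1 : ℝ) * y ^ (k - 1)))
    (y₀ := x) ⟨hx0, hxb⟩ (hα.summable_pow hx0.le hx1.le) ⟨hx0, hxb⟩
  · rw [Nat.choose_one_right]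
    exact (hasDerivAt_pow k y).const_mul (α k)
  · rw [Real.norm_of_nonneg (mul_nonneg (hα.nonneg k)
      (mul_nonneg (by positivity) (pow_nonneg hy.1.le _)))]
    exact mul_le_mul_of_nonneg_left (hK k y hy.1.le hy.2.le) (hα.nonneg k)

omit hα in
theorem binomSum_zero_zero (α : ℕ → ℝ) : binomSum α 0 0 = α 0 := by
  rw [binomSum_zero, tsum_eq_single 0 fun k hk => by rw [zero_pow hk, mul_zero], pow_zero, mul_one]

omit hα in
theorem binomSum_one_zero (α : ℕ → ℝ) : binomSum α 1 0 = α 1 := by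
  rw [binomSum, tsum_eq_single 1]
  · simp
  · intro k hk
    rcases k with _ | _ | k
    · simp
    · exact absurd rfl hk
    · simp

theorem binomSum_one_pos {κ : ℝ} (hκ0 : 0 < κ) (hκ1 : κ < 1) {k : ℕ} (hk : 2 ≤ k)
    (hαk : 0 < α k) : 0 < binomSum α 1 κ := by
  refine (hα.summable_binom 1 hκ0.le hκ1).tsum_pos
    (fun i => mul_nonneg (hα.nonneg i) (by positivity)) k (mul_pos hαk ?_)
  have : 0 < k.choose 1 := Nat.choose_pos (by omega)
  positivity

end IsDefective

/-- `f_s` is the mean of the penalty with `ℓ = 0` at generation `1`. -/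
theorem genFun_eq_binomSum (p : PMF ℕ) (q : ℕ → unitInterval) {s : ℝ} (hs : s ∈ Ioo (0 : ℝ) 1)
    (hq : ∃ k, 0 < (p k).toReal * (q k : ℝ)) {x : ℝ} (hx : x ∈ Icc (0 : ℝ) 1) :
    genFun p q s x = binomSum (fun k => alpha p q k s) 0 x := by
  have h := integral_penalty p q hs hq (ℓ := 0) (by simpa using summable_pmf_toReal p) hx.1 hx.2
    le_rfl 1
  rw [PowerSeries.coeff_zero_eq_constantCoeff_apply, IsDefective.constantCoeff_genSeries_succ,
    ← PowerSeries.coeff_zero_eq_constantCoeff_apply, coeff_genSeries_zero] at h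
  simpa [genFun, penalty, hilbertPoly] using h

/-! ### The limiting regimes. -/

section Cases

variable (p : PMF ℕ) (q : ℕ → unitInterval) {s : ℝ} (hs : s ∈ Ioo (0 : ℝ) 1)
  (hq : ∃ k, 0 < (p k).toReal * (q k : ℝ)) {ℓ : ℕ}
  (hmoment : Summable fun k : ℕ => (k : ℝ) ^ ℓ * (p k).toReal)
include hs

/-- The indicator of `Z_n = r^n` is the coefficient of `X^{r^n}` in `X^{Z_n}`, so the branching
property started from `X` evaluates the integral. -/
theorem integral_pow_M_Z_eq (hr : 1 ≤ minOffspring p) (n : ℕ) :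
    ∫ τ : MarkedTree, s ^ τ.M n * (if τ.Z n = minOffspring p ^ n then 1 else 0) ∂(mgwLaw p q) =
      alpha p q (minOffspring p) s ^ ∑ i ∈ Finset.range n, minOffspring p ^ i := by
  rw [integral_eq_lintegral_of_nonneg_ae]
  · have h1 (τ : MarkedTree) : ENNReal.ofReal
        (s ^ τ.M n * (if τ.Z n = minOffspring p ^ n then 1 else 0)) =
        ENNReal.ofReal s ^ τ.M n * PowerSeries.coeff (minOffspring p ^ n)
          (PowerSeries.X ^ τ.Z n) := by
      rw [PowerSeries.coeff_X_pow, ENNReal.ofReal_mul (pow_nonneg hs.1.le _),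
        ENNReal.ofReal_pow hs.1.le]
      by_cases h : τ.Z n = minOffspring p ^ n
      · simp [h]
      · simp [h, Ne.symm h]
    simp_rw [h1]
    rw [MarkedTree.lintegral_eq_coeff, ealpha_ofReal p q hs, (coeff_iterate_compSeries_X hr
      (fun k hk => by simp [alpha, apply_eq_zero_of_lt_minOffspring hk]) n).2,
      ENNReal.toReal_pow, ENNReal.toReal_ofReal (alpha_nonneg p q hs _)]
  · exact Eventually.of_forall fun τ => mul_nonneg (pow_nonneg hs.1.le _) (by split_ifs <;> simp)
  · exact (MarkedTree.measurable_comp_M_Z' (fun a z => s ^ a *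
      (if z = minOffspring p ^ n then 1 else 0)) n).aestronglyMeasurable

include hq hmoment

/-- Binomial coefficients `C(z, i)` increase with `i` up to `z / 2`, and almost surely `Z_k ≥ r^k ≥
2ℓ` for large `k`. -/
theorem eventually_monotone_coeff {t : ℝ} (ht : 0 ≤ t) (ht1 : t ≤ 1)
    (hr : 2 ≤ minOffspring p) :
    ∀ᶠ k in atTop, ∀ i j, i ≤ j → j ≤ ℓ →
      PowerSeries.coeff i (genSeries (fun k => alpha p q k s) t k) ≤
        PowerSeries.coeff j (genSeries (fun k => alpha p q k s) t k) := by
  filter_upwards [(tendsto_pow_atTop_atTop_of_one_lt (by omega : 1 < minOffspring p)).eventually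
    (eventually_ge_atTop (2 * ℓ))] with k hk i j hij hj
  rw [← integral_penalty p q hs hq hmoment ht ht1 (hij.trans hj),
    ← integral_penalty p q hs hq hmoment ht ht1 hj]
  refine integral_mono_ae (integrable_penalty p q hs hq hmoment ht ht1 (hij.trans hj) k)
    (integrable_penalty p q hs hq hmoment ht ht1 hj k) ?_
  filter_upwards [MarkedTree.ae_minOffspring_pow_le_Z p q k] with τ hτ
  have hch : (τ.Z k).choose i ≤ (τ.Z k).choose j := by
    induction j, hij using Nat.le_induction with
    | base => exact le_rfl
    | succ j hij ih => exact (ih (by omega)).trans (Nat.choose_le_succ_of_lt_half_left (by omega))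
  have hch' : ((τ.Z k).choose i : ℝ) ≤ ((τ.Z k).choose j : ℝ) := by exact_mod_cast hch
  rw [penalty, penalty, hilbertPoly_natCast, hilbertPoly_natCast]
  exact mul_le_mul_of_nonneg_right (mul_le_mul_of_nonneg_right hch' (pow_nonneg hs.1.le _))
    (pow_nonneg ht _)

theorem penalizationLimit_of_linear {t κ : ℝ} (hp : p 0 + p 1 < 1) (ht : 0 < t) (ht1 : t ≤ 1)
    (hκ0 : 0 ≤ κ) (hκ1 : κ < 1) (hκ : binomSum (fun k => alpha p q k s) 0 κ = κ)
    (hγ : 0 < binomSum (fun k => alpha p q k s) 1 κ) (hℓ : 1 ≤ ℓ) :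
    PenalizationLimit (mgwLaw p q) (penalty ℓ s t) fun n τ => s ^ τ.M n *
      ((τ.Z n : ℝ) * κ ^ (τ.Z n - 1) / binomSum (fun k => alpha p q k s) 1 κ ^ n) := by
  have hα := isDefective_alpha p q hs hq
  obtain ⟨k₀, hk₀, hpk₀⟩ := exists_two_le_apply_ne_zero hp
  have hpos : ∀ᶠ k in atTop,
      0 < PowerSeries.coeff ℓ (genSeries (fun k => alpha p q k s) t k) := by
    filter_upwards [eventually_ge_atTop ℓ] with k hk
    exact hα.coeff_genSeries_pos ht ht1 (summable_pow_mul_alpha p q hs hmoment) hk₀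
      (alpha_pos p q hs hpk₀) k ℓ le_rfl (by omega)
  have h1 := hα.tendsto_coeff_genSeries_pow_div hκ0 hκ1 hκ hγ ht.le ht1 hℓ hpos
  have h2 := hα.tendsto_coeff_genSeries_add_div hκ0 hκ1 hκ hγ ht.le ht1 hℓ hpos
  refine penalizationLimit_of_tendsto p q hs hq hmoment ht.le ht1 hpos
    (b := fun n z => (z : ℝ) * κ ^ (z - 1) / binomSum (fun k => alpha p q k s) 1 κ ^ n)
    (fun n z _ => ?_) fun n => ?_
  · refine ((h1 z).div (h2 n) (by positivity)).congr' ?_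
    filter_upwards [hpos] with k hk
    exact div_div_div_cancel_right₀ hk.ne' _ _
  · obtain ⟨K, hK⟩ := hα.exists_coeff_genSeries_pow_div_le hκ0 hκ1 hκ hγ ht.le ht1 hℓ hpos
    set c := binomSum (fun k => alpha p q k s) 1 κ ^ n
    have hc : 0 < c := by positivity
    -- Eventually the normalised denominator exceeds half of its limit `c`.
    refine ⟨K / (c / 2), ?_⟩
    filter_upwards [hpos, hK, (h2 n).eventually_const_lt (half_lt_self hc)] with k hk hKk hck z _
    rw [← div_div_div_cancel_right₀ hk.ne' (PowerSeries.coeff ℓ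
      (genSeries (fun k => alpha p q k s) t k ^ z))]
    have h0 : 0 ≤ PowerSeries.coeff ℓ (genSeries (fun k => alpha p q k s) t k ^ z) /
        PowerSeries.coeff ℓ (genSeries (fun k => alpha p q k s) t k) :=
      div_nonneg (PowerSeries.coeff_pow_nonneg (hα.coeff_genSeries_nonneg ht.le k) _ _) hk.le
    exact div_le_div₀ (h0.trans (hKk z)) (hKk z) (by positivity) hck.le

/-- Numerator and denominator are both divided by the coefficient of `A_k^{r^n}`. For `ℓ = 0` the
required monotonicity is trivial, which admits `r = 1`; otherwise it relies on `r^k → ∞`. -/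
theorem penalizationLimit_of_minimal {t : ℝ} (hp : p 0 + p 1 < 1) (ht : 0 < t) (ht1 : t ≤ 1)
    (hr : 1 ≤ minOffspring p) (hℓr : ℓ = 0 ∨ 2 ≤ minOffspring p) :
    PenalizationLimit (mgwLaw p q) (penalty ℓ s t) fun n τ => s ^ τ.M n *
      ((if τ.Z n = minOffspring p ^ n then 1 else 0) /
        alpha p q (minOffspring p) s ^ ∑ i ∈ Finset.range n, minOffspring p ^ i) := by
  have hα := isDefective_alpha p q hs hq
  set r := minOffspring p with hrdef
  obtain ⟨k₀, hk₀, hpk₀⟩ := exists_two_le_apply_ne_zero hp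
  have h00 : binomSum (fun k => alpha p q k s) 0 0 = 0 := by
    rw [IsDefective.binomSum_zero_zero, alpha,
      apply_eq_zero_of_lt_minOffspring (show 0 < minOffspring p from hr), ENNReal.toReal_zero,
      zero_mul]
  have hpos : ∀ᶠ k in atTop,
      0 < PowerSeries.coeff ℓ (genSeries (fun k => alpha p q k s) t k) := by
    filter_upwards [eventually_ge_atTop ℓ] with k hk
    exact hα.coeff_genSeries_pos ht ht1 (summable_pow_mul_alpha p q hs hmoment) hk₀
      (alpha_pos p q hs hpk₀) k ℓ le_rfl (by omega)
  have hmono : ∀ᶠ k in atTop, ∀ i j, i ≤ j → j ≤ ℓ →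
      PowerSeries.coeff i (genSeries (fun k => alpha p q k s) t k) ≤
        PowerSeries.coeff j (genSeries (fun k => alpha p q k s) t k) := by
    rcases hℓr with rfl | h2
    · refine Eventually.of_forall fun k i j hij hj => ?_
      obtain rfl : j = 0 := by omega
      obtain rfl : i = 0 := by omega
      exact le_rfl
    · exact eventually_monotone_coeff p q hs hq hmoment ht.le ht1 h2
  have ha (k : ℕ) : 0 < PowerSeries.constantCoeff (genSeries (fun k => alpha p q k s) t k) := by
    rw [← PowerSeries.coeff_zero_eq_constantCoeff_apply]
    exact hα.coeff_genSeries_pos ht ht1 (summable_pow_mul_alpha p q hs hmoment) hk₀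
      (alpha_pos p q hs hpk₀) k 0 (Nat.zero_le _) (Nat.zero_le _)
  set A := genSeries (fun k => alpha p q k s) t with hA
  have hnn := hα.coeff_genSeries_nonneg (t := t) ht.le
  have hN (n : ℕ) : 1 ≤ r ^ n := Nat.one_le_pow n r hr
  have hposN (n : ℕ) : ∀ᶠ k in atTop, 0 < PowerSeries.coeff ℓ (A k ^ (r ^ n)) := by
    filter_upwards [hmono] with k hk
    obtain ⟨N, hNeq⟩ := Nat.exists_eq_add_of_le' (hN n)
    rw [hNeq]
    refine lt_of_lt_of_le ?_ (PowerSeries.coeff_pow_le_of_monotone (hnn k) hk N (Nat.zero_le _))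
    rw [PowerSeries.coeff_zero_eq_constantCoeff_apply, map_pow]
    exact pow_pos (ha k) _
  have hsum_nn (k z : ℕ) : 0 ≤ ∑ j ∈ Finset.range (ℓ + 1), PowerSeries.coeff j (A k ^ z) :=
    Finset.sum_nonneg fun j _ => PowerSeries.coeff_pow_nonneg (hnn k) _ _
  have hle (n : ℕ) : ∀ᶠ k in atTop, ∀ z, PowerSeries.coeff ℓ (A k ^ (r ^ n + z)) /
      PowerSeries.coeff ℓ (A k ^ (r ^ n)) ≤
        ∑ j ∈ Finset.range (ℓ + 1), PowerSeries.coeff j (A k ^ z) := by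
    filter_upwards [hmono, hposN n] with k hk hk' z
    rw [div_le_iff₀' hk']
    exact PowerSeries.coeff_pow_add_le (hnn k) hk (hN n) z
  have hratio (n z : ℕ) (hz : r ^ n ≤ z) : Tendsto (fun k => PowerSeries.coeff ℓ (A k ^ z) /
      PowerSeries.coeff ℓ (A k ^ (r ^ n))) atTop (𝓝 (if z = r ^ n then 1 else 0)) := by
    obtain ⟨z, rfl⟩ := Nat.exists_eq_add_of_le hz
    rcases z with _ | z
    · rw [add_zero, if_pos rfl]
      refine tendsto_const_nhds.congr' ?_
      filter_upwards [hposN n] with k hk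
      exact (div_self hk.ne').symm
    · rw [if_neg (by omega)]
      have h0 : Tendsto (fun k => ∑ j ∈ Finset.range (ℓ + 1),
          PowerSeries.coeff j (A k ^ (z + 1))) atTop (𝓝 0) := by
        have := tendsto_finsetSum (Finset.range (ℓ + 1)) fun j _ =>
          hα.tendsto_coeff_genSeries_pow_zero h00 ht.le ht1 z j
        simpa using this
      refine squeeze_zero' (Eventually.of_forall fun k => div_nonneg
        (PowerSeries.coeff_pow_nonneg (hnn k) _ _) (PowerSeries.coeff_pow_nonneg (hnn k) _ _)) ?_ h0
      filter_upwards [hle n] with k hk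
      exact hk (z + 1)
  choose K hK0 hK using fun j => hα.exists_coeff_genSeries_pow_le le_rfl zero_lt_one h00 ht.le ht1 j
  have hKall : ∀ᶠ k in atTop, ∀ j ∈ Finset.range (ℓ + 1), ∀ z,
      PowerSeries.coeff j (A k ^ z) ≤ K j := by
    rw [Filter.eventually_all_finset]
    exact fun j _ => hK j
  have hbound (n : ℕ) : ∀ᶠ k in atTop, ∀ z, r ^ n ≤ z → PowerSeries.coeff ℓ (A k ^ z) /
      PowerSeries.coeff ℓ (A k ^ (r ^ n)) ≤ ∑ j ∈ Finset.range (ℓ + 1), K j := by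
    filter_upwards [hle n, hKall] with k hk hk' z hz
    obtain ⟨z, rfl⟩ := Nat.exists_eq_add_of_le hz
    exact (hk z).trans (Finset.sum_le_sum fun j hj => hk' j hj z)
  set c : ℕ → ℝ := fun n => alpha p q r s ^ ∑ i ∈ Finset.range n, r ^ i with hc
  have hcpos (n : ℕ) : 0 < c n := pow_pos (alpha_pos p q hs (apply_minOffspring_ne_zero p)) _
  -- The denominator is itself the mean of `s^{M_n} [X^ℓ] A_k^{Z_n}`, so dominated convergence on
  -- the whole space gives its limit `𝔼[s^{M_n} 1_{Z_n = r^n}]`.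
  have hden (n : ℕ) : Tendsto (fun k => PowerSeries.coeff ℓ (A (n + k)) /
      PowerSeries.coeff ℓ (A k ^ (r ^ n))) atTop (𝓝 (c n)) := by
    have h := tendsto_setIntegral_comp_Z p q hs n
      (g := fun k z => PowerSeries.coeff ℓ (A k ^ z) / PowerSeries.coeff ℓ (A k ^ (r ^ n)))
      (Eventually.of_forall fun k z => div_nonneg (PowerSeries.coeff_pow_nonneg (hnn k) _ _)
        (PowerSeries.coeff_pow_nonneg (hnn k) _ _)) (hbound n) (hratio n) Set.univ
    simp only [Measure.restrict_univ] at h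
    rw [integral_pow_M_Z_eq p q hs hr n] at h
    refine h.congr fun k => ?_
    have h2 := setIntegral_penalty p q hs hq hmoment ht.le ht1 le_rfl n k (Λ := Set.univ)
      (@MeasurableSet.univ _ (MarkedTree.filtration n))
    simp only [Measure.restrict_univ] at h2
    rw [integral_penalty p q hs hq hmoment ht.le ht1 le_rfl] at h2
    rw [h2, ← integral_div]
    simp_rw [mul_div_assoc]
    rfl
  refine penalizationLimit_of_tendsto p q hs hq hmoment ht.le ht1 hpos
    (b := fun n z => (if z = r ^ n then 1 else 0) / c n) (fun n z hz => ?_) fun n => ?_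
  · refine ((hratio n z hz).div (hden n) (hcpos n).ne').congr' ?_
    filter_upwards [hposN n] with k hk
    exact div_div_div_cancel_right₀ hk.ne' _ _
  · refine ⟨(∑ j ∈ Finset.range (ℓ + 1), K j) / (c n / 2), ?_⟩
    filter_upwards [hposN n, hbound n, (hden n).eventually_const_lt (half_lt_self (hcpos n))]
      with k hk hKk hck z hz
    rw [← div_div_div_cancel_right₀ hk.ne' (PowerSeries.coeff ℓ (A k ^ z))]
    exact div_le_div₀ (Finset.sum_nonneg fun j _ => hK0 j) (hKk z hz) (half_pos (hcpos n)) hck.le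

omit hmoment in
theorem penalizationLimit_of_fixedPoint_pos {t κ : ℝ} (ht : 0 ≤ t) (ht1 : t ≤ 1)
    (hκ0 : 0 < κ) (hκ1 : κ < 1) (hκ : binomSum (fun k => alpha p q k s) 0 κ = κ) :
    PenalizationLimit (mgwLaw p q) (penalty 0 s t)
      fun n τ => s ^ τ.M n * κ ^ ((τ.Z n : ℤ) - 1) := by
  have hα := isDefective_alpha p q hs hq
  have ha := hα.tendsto_constantCoeff_genSeries hκ0.le hκ1 hκ ht ht1
  have hmom : Summable fun k : ℕ => (k : ℝ) ^ 0 * (p k).toReal := by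
    simpa using summable_pmf_toReal p
  have hshift (n : ℕ) := (tendsto_add_atTop_iff_nat n).2 ha
  refine penalizationLimit_of_tendsto p q hs hq hmom ht ht1 ?_
    (b := fun _ z => κ ^ ((z : ℤ) - 1)) (fun n z _ => ?_) fun n => ?_
  · simpa using ha.eventually_const_lt hκ0
  -- The exponent is an integer because extinction, `z = 0`, contributes `κ⁻¹`.
  · rw [zpow_sub_one₀ hκ0.ne', zpow_natCast, ← div_eq_mul_inv]
    refine ((ha.pow z).div (hshift n) hκ0.ne').congr fun k => ?_
    simp [add_comm]
  · refine ⟨1 / (κ / 2), ?_⟩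
    filter_upwards [(hshift n).eventually_const_lt (half_lt_self hκ0)] with k hk z _
    simp only [PowerSeries.coeff_zero_eq_constantCoeff_apply, map_pow, add_comm n k]
    exact div_le_div₀ zero_le_one (pow_le_one₀ (hα.constantCoeff_genSeries_nonneg ht k)
      (hα.constantCoeff_genSeries_le_one ht ht1 k)) (half_pos hκ0) hk.le

end Cases

theorem theorem3 (p : PMF ℕ) (q : ℕ → unitInterval) (ℓ : ℕ)
    (hp : p 0 + p 1 < 1)
    (hmean : Summable fun k : ℕ => (k : ℝ) * (p k).toReal)
    (hmoment : Summable fun k : ℕ => (k : ℝ) ^ ℓ * (p k).toReal)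
    (hq : ∃ k, 0 < (p k).toReal * (q k : ℝ))
    (s : ℝ) (hs : s ∈ Set.Ioo (0 : ℝ) 1) :
    ∃ κ ∈ Set.Icc (0 : ℝ) 1, genFun p q s κ = κ ∧
      (∀ x ∈ Set.Icc (0 : ℝ) 1, genFun p q s x = x → x = κ) ∧
      (minOffspring p = 0 → ℓ = 0 → 0 < κ ∧
        ∀ t ∈ Set.Icc (0 : ℝ) 1,
          PenalizationLimit (mgwLaw p q) (penalty ℓ s t)
            (fun n τ => s ^ τ.M n * κ ^ ((τ.Z n : ℤ) - 1))) ∧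
      (minOffspring p = 0 → 0 < ℓ → 0 < κ ∧
        DifferentiableAt ℝ (genFun p q s) κ ∧ 0 < deriv (genFun p q s) κ ∧
        ∀ t ∈ Set.Ioc (0 : ℝ) 1,
          PenalizationLimit (mgwLaw p q) (penalty ℓ s t)
            (fun n τ => s ^ τ.M n * (τ.Z n : ℝ) * κ ^ ((τ.Z n : ℤ) - 1) /
              deriv (genFun p q s) κ ^ n)) ∧
      (minOffspring p = 1 →
        ∀ t ∈ Set.Ioc (0 : ℝ) 1,
          PenalizationLimit (mgwLaw p q) (penalty ℓ s t)
            (fun n τ => s ^ τ.M n * (alpha p q 1 s)⁻¹ ^ n *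
              (if τ.Z n = 1 then 1 else 0))) ∧
      (2 ≤ minOffspring p →
        ∀ t ∈ Set.Ioc (0 : ℝ) 1,
          PenalizationLimit (mgwLaw p q) (penalty ℓ s t)
            (fun n τ => s ^ τ.M n *
              alpha p q (minOffspring p) s ^
                (-(((minOffspring p : ℝ) ^ n - 1) / ((minOffspring p : ℝ) - 1))) *
              (if τ.Z n = minOffspring p ^ n then 1 else 0)))
:= by
  have hα := isDefective_alpha p q hs hq
  obtain ⟨k₀, hk₀, hpk₀⟩ := exists_two_le_apply_ne_zero hp
  obtain ⟨κ, hκ0, hκ1, hκ⟩ := hα.exists_fixedPoint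
  have hgen {x : ℝ} (hx : x ∈ Icc (0 : ℝ) 1) := genFun_eq_binomSum p q hs hq hx
  have hκpos (hr : minOffspring p = 0) : 0 < κ := by
    refine lt_of_le_of_ne hκ0 ?_
    rintro rfl
    -- For `r = 0` the value of `f_s` at `0` is `α_0(s) > 0`, so `0` is not fixed.
    rw [IsDefective.binomSum_zero_zero] at hκ
    exact (alpha_pos p q hs (hr ▸ apply_minOffspring_ne_zero p)).ne' hκ
  refine ⟨κ, ⟨hκ0, hκ1.le⟩, (hgen ⟨hκ0, hκ1.le⟩).trans hκ, fun x hx hfx => ?_, fun hr hℓ => ?_,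
    fun hr hℓ => ?_, fun hr t ht => ?_, fun hr t ht => ?_⟩
  · exact hα.eq_of_fixedPoint hκ0 hκ1 hκ hx.1 hx.2 ((hgen hx).symm.trans hfx)
  · subst hℓ
    exact ⟨hκpos hr, fun t ht =>
      penalizationLimit_of_fixedPoint_pos p q hs hq ht.1 ht.2 (hκpos hr) hκ1 hκ⟩
  · have hpos := hκpos hr
    have hder : HasDerivAt (genFun p q s) (binomSum (fun k => alpha p q k s) 1 κ) κ := by
      refine (hα.hasDerivAt_binomSum_zero hpos hκ1).congr_of_eventuallyEq ?_
      filter_upwards [Ioo_mem_nhds hpos hκ1] with x hx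
      exact hgen (Ioo_subset_Icc_self hx)
    have hγ := hα.binomSum_one_pos hpos hκ1 hk₀ (alpha_pos p q hs hpk₀)
    refine ⟨hpos, hder.differentiableAt, hder.deriv ▸ hγ, fun t ht => ?_⟩
    convert penalizationLimit_of_linear p q hs hq hmoment hp ht.1 ht.2 hκ0 hκ1 hκ hγ hℓ using 3
      with n τ
    rw [hder.deriv, mul_div_assoc, mul_div_assoc, mul_assoc]
    congr 1
    -- Truncated and integer exponents differ only at `Z_n = 0`, where the factor `Z_n` vanishes.
    rcases Nat.eq_zero_or_pos (τ.Z n) with h0 | h0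
    · simp [h0]
    · rw [← Nat.cast_pred h0, zpow_natCast]
  · rcases Nat.eq_zero_or_pos ℓ with hℓ | hℓ
    · convert penalizationLimit_of_minimal p q hs hq hmoment hp ht.1 ht.2 hr.ge (Or.inl hℓ) using 3
        with n τ
      rw [hr]
      simp only [one_pow, Finset.sum_const, Finset.card_range, smul_eq_mul, mul_one, inv_pow]
      ring
    · have h00 : binomSum (fun k => alpha p q k s) 0 0 = 0 := by
        rw [IsDefective.binomSum_zero_zero, alpha,
          apply_eq_zero_of_lt_minOffspring (by omega), ENNReal.toReal_zero, zero_mul]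
      have hγ : 0 < binomSum (fun k => alpha p q k s) 1 0 := by
        rw [IsDefective.binomSum_one_zero]
        exact alpha_pos p q hs (hr ▸ apply_minOffspring_ne_zero p)
      convert penalizationLimit_of_linear p q hs hq hmoment hp ht.1 ht.2 le_rfl zero_lt_one h00 hγ
        hℓ using 3 with n τ
      rw [IsDefective.binomSum_one_zero, mul_assoc, inv_pow]
      congr 1
      -- With `κ = 0`, `z * 0 ^ (z - 1)` is the indicator of `z = 1`, since `0 ^ 0 = 1` and the
      -- factor `z` kills `z = 0`.
      rcases h : τ.Z n with _ | _ | z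
      · simp
      · simp
      · simp
  · convert penalizationLimit_of_minimal p q hs hq hmoment hp ht.1 ht.2 (by omega) (Or.inr hr)
      using 3 with n τ
    have hr1 : (minOffspring p : ℝ) ≠ 1 := by
      have : (2 : ℝ) ≤ minOffspring p := by exact_mod_cast hr
      linarith
    have hexp : ((minOffspring p : ℝ) ^ n - 1) / ((minOffspring p : ℝ) - 1) =
        ((∑ i ∈ Finset.range n, minOffspring p ^ i : ℕ) : ℝ) := by
      rw [← geom_sum_eq hr1]
      push_cast
      rfl
    rw [hexp, Real.rpow_neg (alpha_nonneg p q hs _), Real.rpow_natCast]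
    ring
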